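/- For a positive integer $n$, let $D(n)$ denote the difference between the largest and the smallest coefficient of the $n$th cyclotomic polynomial $\Phi_n$. Let $p$ be an odd prime. For an integer $d$, say that $D(pqr)=d$ is soluble in arbitrarily large primes if for every $N$ there are primes $q$ and $r$ with $q,r>N$, $p<q<r$ and $D(pqr)=d$. Then $D(pqr)=d$ is soluble in arbitrarily large primes for each of the following values of $d$: 1. $d=2$; 2. $d=2h$, for each integer $h$ with $3\le h<\sqrt p$; 3. $d=p$; 4. $d=p-2k$, for each integer $k$ with $1\le k<\sqrt p/2-1$. -/

import Mathlib

/-- The largest coefficient of an integer polynomial `f`, among the coefficients of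
`x ^ m` with `0 ≤ m ≤ deg f`. -/
def maxCoeff (f : Polynomial ℤ) : ℤ :=
  (Finset.range (f.natDegree + 1)).sup' ⟨0, by simp⟩ f.coeff

/-- The smallest coefficient of an integer polynomial `f`, among the coefficients of
`x ^ m` with `0 ≤ m ≤ deg f`. -/
def minCoeff (f : Polynomial ℤ) : ℤ :=
  (Finset.range (f.natDegree + 1)).inf' ⟨0, by simp⟩ f.coeff

/-- The diameter `D(n)` of the `n`-th cyclotomic polynomial: the difference between its
largest and its smallest coefficient. -/
noncomputable def cyclotomicDiameter (n : ℕ) : ℤ :=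
  maxCoeff (Polynomial.cyclotomic n ℤ) - minCoeff (Polynomial.cyclotomic n ℤ)

/-- There are arbitrarily large primes `q` and `r`, with `p < q < r`, such that
`D(p q r) = d`. -/
def SolubleInLargePrimes (p : ℕ) (d : ℤ) : Prop :=
  ∀ N : ℕ, ∃ q r : ℕ, q.Prime ∧ r.Prime ∧ N < q ∧ N < r ∧ p < q ∧ q < r ∧
    cyclotomicDiameter (p * q * r) = d

/-! The values come from a family of ternary polynomials whose diameter is known exactly. Let 1 ≤ e
< p/2, let u > p be an inverse of e modulo p, let q > up be a prime with q ≡ ηu (mod p), η = ±1, and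
let r > pq be a prime inverse to u modulo pq. For η = -1 the diameter is 2e. For η = 1 it is 2e + 1,
provided the residue v of u modulo p satisfies v ≤ e or v ≥ p - e.

As a power series, Φ_{pq} is (1 - X) times the generating series of the semigroup ⟨p, q⟩. Dividing
Φ_{pq}(X^r) Φ_p(X) (X^q - 1) by X^{pq} - 1 writes a coefficient of Φ_{pqr} as a difference of two
truncated sums of coefficients of Φ_{pq} along progressions of difference u. The untruncated sums
agree, so a single progression of length at most p remains, with a sign (`coeff_cases`).

Since ue ≡ 1 (mod p), the predecessor of term i + e is congruent to term i, and the indicator of the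
semigroup nearly cancels between them: e terms are left at each end, and at most one jump, because a
progression spans less than q. So every sum lies in [-e-1, e]. The value -e-1 needs a multiple Jq
inside the progression. This is impossible for η = -1; for η = 1 it forces e ≤ J < p - e, and the
condition on v then admits only one of the two signs. Explicit progressions attain the remaining
extremes.

Dirichlet's theorem supplies q and r. For d = 2h take e = h. For d = p - 2k take e = (p-1)/2 - k;
then (2v - p)(2k + 1) ≡ -4 (mod p) keeps v away from p/2. -/

/-! ### Binary cyclotomic coefficients and the semigroup generated by p and q -/

open Polynomial in
theorem cyclotomic_mul_prime_mul_cyclotomic {p q : ℕ} (hp : p.Prime) (hq : q.Prime) (hpq : p ≠ q) :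
    cyclotomic (p * q) ℤ * cyclotomic p ℤ = ∑ j ∈ Finset.range p, (X : ℤ[X]) ^ (j * q) := by
  have hnd : ¬ q ∣ p := fun h => hpq ((Nat.prime_dvd_prime_iff_eq hq hp).1 h).symm
  have : Fact p.Prime := ⟨hp⟩
  rw [← cyclotomic_expand_eq_cyclotomic_mul hq hnd, cyclotomic_prime, map_sum]
  refine Finset.sum_congr rfl fun j _ => ?_
  rw [map_pow, expand_X, ← pow_mul, mul_comm]

/-- The indicator function of the numerical semigroup generated by `p` and `q`, each element being
written as `i * p + j * q` with `j < p`. -/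
def semigroupInd (p q : ℕ) (z : ℤ) : ℤ :=
  ∑ j ∈ Finset.range p, if (j : ℤ) * q ≤ z ∧ (p : ℤ) ∣ z - j * q then 1 else 0

/-- The coefficients of the binary cyclotomic polynomial of index `p * q`, as a function on `ℤ`. -/
def binaryCoeff (p q : ℕ) (z : ℤ) : ℤ := semigroupInd p q z - semigroupInd p q (z - 1)

theorem semigroupInd_of_neg {p q : ℕ} {z : ℤ} (hz : z < 0) : semigroupInd p q z = 0 := by
  refine Finset.sum_eq_zero fun j _ => if_neg fun h => ?_
  have : (0 : ℤ) ≤ (j : ℤ) * q := by positivity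
  linarith [h.1]

theorem semigroupInd_sub {p q : ℕ} (hp : 0 < p) (z : ℤ) :
    semigroupInd p q z - semigroupInd p q (z - p) =
      ∑ j ∈ Finset.range p, if z = (j : ℤ) * q then 1 else 0 := by
  unfold semigroupInd
  rw [← Finset.sum_sub_distrib]
  refine Finset.sum_congr rfl fun j _ => ?_
  have hp' : (0 : ℤ) < p := by exact_mod_cast hp
  have hd : (p : ℤ) ∣ z - p - j * q ↔ (p : ℤ) ∣ z - j * q := by
    rw [show z - p - j * q = (z - j * q) - p by ring]
    exact dvd_sub_self_right
  simp only [hd]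
  by_cases hz : z = (j : ℤ) * q
  · rw [if_pos hz, if_pos ⟨hz.ge, by simp [hz]⟩, if_neg (fun h => by linarith [h.1]), sub_zero]
  · rw [if_neg hz, sub_eq_zero]
    refine if_congr ⟨fun h => ⟨?_, h.2⟩, fun h => ⟨by linarith [h.1], h.2⟩⟩ rfl rfl
    have hlt : 0 < z - j * q := by
      rcases lt_or_eq_of_le h.1 with h1 | h1
      · linarith
      · exact absurd h1.symm hz
    linarith [Int.le_of_dvd hlt h.2]

theorem binaryCoeff_of_neg {p q : ℕ} {z : ℤ} (hz : z < 0) : binaryCoeff p q z = 0 := by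
  rw [binaryCoeff, semigroupInd_of_neg hz, semigroupInd_of_neg (by linarith), sub_zero]

-- Multiplying Φ_{pq} Φ_p = ∑ X^{jq} by X - 1 gives a recurrence of step p for the coefficients; the
-- indicator satisfies the same one by `semigroupInd_sub`.
open Polynomial in
theorem coeff_cyclotomic_mul_prime {p q : ℕ} (hp : p.Prime) (hq : q.Prime) (hpq : p ≠ q) (n : ℕ) :
    (cyclotomic (p * q) ℤ).coeff n = binaryCoeff p q n := by
  have : Fact p.Prime := ⟨hp⟩
  have hid : cyclotomic (p * q) ℤ * X ^ p - cyclotomic (p * q) ℤ =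
      (∑ j ∈ Finset.range p, (X : ℤ[X]) ^ (j * q)) * X -
        ∑ j ∈ Finset.range p, (X : ℤ[X]) ^ (j * q) := by
    rw [← cyclotomic_mul_prime_mul_cyclotomic hp hq hpq]
    linear_combination -cyclotomic (p * q) ℤ * cyclotomic_prime_mul_X_sub_one ℤ p
  have hsum : ∀ m : ℕ, (∑ j ∈ Finset.range p, (X : ℤ[X]) ^ (j * q)).coeff m =
      semigroupInd p q m - semigroupInd p q (m - p) := by
    intro m
    rw [semigroupInd_sub hp.pos, finsetSum_coeff]
    refine Finset.sum_congr rfl fun j _ => ?_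
    rw [coeff_X_pow]
    exact if_congr (by norm_cast) rfl rfl
  induction n using Nat.strong_induction_on with
  | _ n ih =>
    have h := congrArg (fun f : ℤ[X] => f.coeff n) hid
    simp only [coeff_sub, coeff_mul_X_pow'] at h
    have h1 : ((∑ j ∈ Finset.range p, (X : ℤ[X]) ^ (j * q)) * X).coeff n =
        semigroupInd p q ((n : ℤ) - 1) - semigroupInd p q ((n : ℤ) - 1 - p) := by
      cases n with
      | zero =>
        rw [coeff_mul_X_zero, semigroupInd_of_neg (by simp), semigroupInd_of_neg, sub_zero]
        simp only [Nat.cast_zero]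
        have := hp.pos
        omega
      | succ n =>
        rw [coeff_mul_X, hsum]
        push_cast
        ring_nf
    rw [h1, hsum] at h
    have h2 : (if p ≤ n then (cyclotomic (p * q) ℤ).coeff (n - p) else 0) =
        binaryCoeff p q ((n : ℤ) - p) := by
      split_ifs with hn
      · rw [ih (n - p) (by have := hp.pos; omega), Nat.cast_sub hn]
      · rw [binaryCoeff_of_neg]
        omega
    rw [h2] at h
    unfold binaryCoeff at h ⊢
    rw [show (n : ℤ) - p - 1 = n - 1 - p by ring] at h
    linarith

theorem exists_lt_dvd_sub_mul {p q : ℕ} (hp : p.Prime) (hq : q.Prime) (hpq : p ≠ q) (z : ℤ) :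
    ∃ j : ℕ, j < p ∧ (p : ℤ) ∣ z - j * q := by
  have hc : IsCoprime (q : ℤ) (p : ℤ) :=
    Nat.isCoprime_iff_coprime.2 ((Nat.coprime_primes hq hp).2 hpq.symm)
  obtain ⟨a, b, hab⟩ := hc
  have hp0 : (0 : ℤ) < p := by exact_mod_cast hp.pos
  have h0 := Int.emod_nonneg (z * a) hp0.ne'
  have h1 := Int.emod_lt_of_pos (z * a) hp0
  refine ⟨((z * a) % p).toNat, by omega, ?_⟩
  rw [Int.toNat_of_nonneg h0]
  refine ⟨z * b + (z * a / p) * q, ?_⟩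
  have := Int.emod_add_mul_ediv (z * a) p
  linear_combination (-(z : ℤ)) * hab + (q : ℤ) * (-this)

theorem semigroupInd_eq {p q : ℕ} (hp : p.Prime) (hq : q.Prime) (hpq : p ≠ q) {z : ℤ} {j : ℕ}
    (hj : j < p) (hd : (p : ℤ) ∣ z - j * q) :
    semigroupInd p q z = if (j : ℤ) * q ≤ z then 1 else 0 := by
  unfold semigroupInd
  rw [Finset.sum_eq_single_of_mem j (Finset.mem_range.2 hj)]
  · simp [hd]
  · intro i hi hij
    refine if_neg fun h => hij ?_
    have hc : IsCoprime (p : ℤ) (q : ℤ) :=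
      Nat.isCoprime_iff_coprime.2 ((Nat.coprime_primes hp hq).2 hpq)
    have h2 : (p : ℤ) ∣ ((i : ℤ) - j) * q := by
      have := dvd_sub hd h.2
      rwa [show z - j * q - (z - i * q) = ((i : ℤ) - j) * q by ring] at this
    have h3 := hc.dvd_of_dvd_mul_right h2
    have h4 := Int.eq_zero_of_abs_lt_dvd h3 (by
      rw [Finset.mem_range] at hi
      rw [abs_lt]
      omega)
    omega

theorem semigroupInd_nonneg (p q : ℕ) (z : ℤ) : 0 ≤ semigroupInd p q z :=
  Finset.sum_nonneg fun j _ => by split_ifs <;> simp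

theorem semigroupInd_le_one {p q : ℕ} (hp : p.Prime) (hq : q.Prime) (hpq : p ≠ q) (z : ℤ) :
    semigroupInd p q z ≤ 1 := by
  obtain ⟨j, hj, hd⟩ := exists_lt_dvd_sub_mul hp hq hpq z
  rw [semigroupInd_eq hp hq hpq hj hd]
  split_ifs <;> simp

theorem semigroupInd_mono {p q : ℕ} {y z : ℤ} (hyz : y ≤ z) (hd : (p : ℤ) ∣ z - y) :
    semigroupInd p q y ≤ semigroupInd p q z := by
  refine Finset.sum_le_sum fun j _ => ?_
  by_cases h : (j : ℤ) * q ≤ y ∧ (p : ℤ) ∣ y - j * q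
  · have h' : (j : ℤ) * q ≤ z ∧ (p : ℤ) ∣ z - j * q := by
      refine ⟨h.1.trans hyz, ?_⟩
      rw [show z - j * q = (z - y) + (y - j * q) by ring]
      exact dvd_add hd h.2
    rw [if_pos h, if_pos h']
  · rw [if_neg h]
    split_ifs <;> simp

theorem binaryCoeff_of_large {p q : ℕ} (hp : p.Prime) (hq : q.Prime) (hpq : p ≠ q) {z : ℤ}
    (hz : (p : ℤ) * q - p - q + 2 ≤ z) : binaryCoeff p q z = 0 := by
  -- The Frobenius number of p and q is pq - p - q, so the indicator is constantly 1 beyond it.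
  have key : ∀ y : ℤ, (p : ℤ) * q - p - q + 1 ≤ y → semigroupInd p q y = 1 := by
    intro y hy
    obtain ⟨j, hj, hd⟩ := exists_lt_dvd_sub_mul hp hq hpq y
    rw [semigroupInd_eq hp hq hpq hj hd, if_pos]
    by_contra hlt
    push Not at hlt
    have h1 : (p : ℤ) ≤ j * q - y :=
      Int.le_of_dvd (by linarith) (by rw [← dvd_neg, neg_sub]; exact hd)
    have h2 : (j : ℤ) * q ≤ (p - 1) * q := by
      refine mul_le_mul_of_nonneg_right (by omega) (by positivity)
    nlinarith
  rw [binaryCoeff, key z (by linarith), key (z - 1) (by linarith), sub_self]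
-- Bounds for sums of binary coefficients along progressions
/-- Numerical data for a family of ternary cyclotomic polynomials: `u` is an inverse of `e` modulo
`p`, and `q` is a large prime congruent to `η * u` modulo `p`. -/
structure ProgressionData (p q u e : ℕ) (η : ℤ) : Prop where
  prime_p : p.Prime
  prime_q : q.Prime
  one_le : 1 ≤ e
  two_mul_lt : 2 * e < p
  p_lt_u : p < u
  mul_lt : u * p < q
  dvd_mul_sub : (p : ℤ) ∣ u * e - 1
  dvd_sub : (p : ℤ) ∣ q - η * u
  eta : η = 1 ∨ η = -1

/-- The sum of the coefficients of `Φ_{pq}` along an arithmetic progression of length `M`,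
starting at `x` and with common difference `u`. -/
def progressionSum (p q u : ℕ) (x : ℤ) (M : ℕ) : ℤ :=
  ∑ i ∈ Finset.range M, binaryCoeff p q (x + u * i)

namespace ProgressionData

variable {p q u e : ℕ} {η : ℤ}

theorem p_ne_q (D : ProgressionData p q u e η) : p ≠ q := by
  have := D.mul_lt
  have := D.p_lt_u
  have := D.prime_p.pos
  nlinarith

theorem ind_eq (D : ProgressionData p q u e η) {z : ℤ} {j : ℕ}
    (hj : j < p) (hd : (p : ℤ) ∣ z - j * q) :
    semigroupInd p q z = if (j : ℤ) * q ≤ z then 1 else 0 :=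
  semigroupInd_eq D.prime_p D.prime_q D.p_ne_q hj hd

theorem exists_class (D : ProgressionData p q u e η) (z : ℤ) :
    ∃ j : ℕ, j < p ∧ (p : ℤ) ∣ z - j * q :=
  exists_lt_dvd_sub_mul D.prime_p D.prime_q D.p_ne_q z

theorem ind_le_one (D : ProgressionData p q u e η) (z : ℤ) : semigroupInd p q z ≤ 1 :=
  semigroupInd_le_one D.prime_p D.prime_q D.p_ne_q z

theorem p_lt_mul (D : ProgressionData p q u e η) : (p : ℤ) < u * e := by
  have h1 : (p : ℤ) < u := by exact_mod_cast D.p_lt_u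
  have h2 : (1 : ℤ) ≤ e := by exact_mod_cast D.one_le
  nlinarith

theorem span_lt (D : ProgressionData p q u e η) {i : ℕ} (hi : i ≤ p) : (u : ℤ) * i < q := by
  have h1 : (u : ℤ) * p < q := by exact_mod_cast D.mul_lt
  have h2 : (i : ℤ) ≤ p := by exact_mod_cast hi
  have h3 : (0 : ℤ) ≤ u := by positivity
  nlinarith

/-- Residue classes modulo `p` in terms of the multiple of `q` they contain. -/
theorem dvd_class_sub (D : ProgressionData p q u e η) {z z' j j' : ℤ}
    (hz : (p : ℤ) ∣ z - j * q) (hz' : (p : ℤ) ∣ z' - j' * q) {s t : ℤ}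
    (hst : z' - z = u * s + t) : (p : ℤ) ∣ (j' - j) - η * (s + t * e) := by
  obtain ⟨a, ha⟩ := hz
  obtain ⟨b, hb⟩ := hz'
  obtain ⟨c, hc⟩ := D.dvd_mul_sub
  obtain ⟨d, hd⟩ := D.dvd_sub
  have hη : η * η = 1 := by rcases D.eta with h | h <;> simp [h]
  -- From q ≡ ηu and ue ≡ 1 modulo p, the class of z is j ≡ ηez; a step u moves it by η and a step 1
  -- by ηe.
  refine ⟨-(j' - j) * c + η * e * (a - b) - (j' - j) * η * e * d + η * s * c, ?_⟩
  linear_combination (-(j' - j)) * hc + η * e * (ha - hb) - (j' - j) * η * e * hd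
    + η * s * hc + η * e * hst - (j' - j) * u * e * hη

theorem eq_of_dvd_window (D : ProgressionData p q u e η) {x : ℤ} {c d J J' : ℕ}
    (hc : c < p) (hd : d < p)
    (h1 : (p : ℤ) ∣ x + u * c - J * q) (h2 : (p : ℤ) ∣ x + u * d - J' * q) (hJ : J = J') :
    c = d := by
  subst hJ
  have h := D.dvd_class_sub h1 h2 (s := d - c) (t := 0) (by ring)
  have h3 : (p : ℤ) ∣ (d : ℤ) - c := by
    rcases D.eta with h' | h' <;> subst h'
    · rwa [show (J : ℤ) - J - 1 * (d - c + 0 * e) = -(d - c) by ring, dvd_neg] at h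
    · rwa [show (J : ℤ) - J - -1 * (d - c + 0 * e) = d - c by ring] at h
  have := Int.eq_zero_of_abs_lt_dvd h3 (by rw [abs_lt]; omega)
  omega

theorem eq_of_mul_mem_window (D : ProgressionData p q u e η) {x : ℤ} {J J' : ℕ} {M : ℕ}
    (hM : M ≤ p) (h1 : x < J * q) (h2 : (J : ℤ) * q < x + u * M)
    (h3 : x < J' * q) (h4 : (J' : ℤ) * q < x + u * M) : J = J' := by
  have hs := D.span_lt hM
  have hq : (0 : ℤ) < q := by exact_mod_cast D.prime_q.pos
  have a1 : (J : ℤ) < J' + 1 := by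
    refine lt_of_mul_lt_mul_right ?_ hq.le
    linarith
  have a2 : (J' : ℤ) < J + 1 := by
    refine lt_of_mul_lt_mul_right ?_ hq.le
    linarith
  omega

/-- If an indicator value increases between two congruent positions, a multiple of `q` in their
residue class lies in between. -/
theorem exists_jump (D : ProgressionData p q u e η) {y z : ℤ} (hd : (p : ℤ) ∣ z - y)
    (hne : semigroupInd p q z - semigroupInd p q y ≠ 0) (hyz : y ≤ z) :
    ∃ J : ℕ, J < p ∧ (p : ℤ) ∣ y - J * q ∧ y < J * q ∧ (J : ℤ) * q ≤ z := by
  obtain ⟨J, hJ, hy⟩ := D.exists_class y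
  have hz : (p : ℤ) ∣ z - J * q := by
    rw [show z - (J : ℤ) * q = (z - y) + (y - J * q) by ring]
    exact dvd_add hd hy
  rw [D.ind_eq hJ hz, D.ind_eq hJ hy] at hne
  refine ⟨J, hJ, hy, ?_⟩
  split_ifs at hne with h1 h2 h3
  · simp at hne
  · exact ⟨not_le.1 h2, h1⟩
  · exact absurd (h3.trans hyz) h1
  · simp at hne

/-- Terms and predecessors are cut at opposite ends, so that term i meets the predecessor of term e
+ i, which is congruent to it modulo p. -/
theorem progressionSum_split (e L : ℕ) (x : ℤ) :
    progressionSum p q u x (e + L) =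
      ∑ i ∈ Finset.range e, (semigroupInd p q (x + u * ((L + i : ℕ) : ℤ)) -
          semigroupInd p q (x + u * i - 1)) -
        ∑ i ∈ Finset.range L, (semigroupInd p q (x + u * ((e + i : ℕ) : ℤ) - 1) -
          semigroupInd p q (x + u * i)) := by
  unfold progressionSum binaryCoeff
  rw [Finset.sum_sub_distrib, Finset.sum_sub_distrib, Finset.sum_sub_distrib,
    Finset.sum_range_add (fun i : ℕ => semigroupInd p q (x + u * i - 1)) e L, add_comm e L,
    Finset.sum_range_add (fun i : ℕ => semigroupInd p q (x + u * i)) L e]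
  ring

theorem dvd_shift (D : ProgressionData p q u e η) (x : ℤ) (i : ℕ) :
    (p : ℤ) ∣ (x + u * ((e + i : ℕ) : ℤ) - 1) - (x + u * i) := by
  have := D.dvd_mul_sub
  push_cast
  rwa [show x + u * ((e : ℤ) + i) - 1 - (x + u * i) = u * e - 1 by ring]

theorem le_shift (D : ProgressionData p q u e η) (x : ℤ) (i : ℕ) :
    x + u * i ≤ x + u * ((e + i : ℕ) : ℤ) - 1 := by
  have := D.p_lt_mul
  have hp : (0 : ℤ) < p := by exact_mod_cast D.prime_p.pos
  push_cast
  linarith [mul_add (u : ℤ) e i]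

theorem shift_nonneg (D : ProgressionData p q u e η) (x : ℤ) (i : ℕ) :
    0 ≤ semigroupInd p q (x + u * ((e + i : ℕ) : ℤ) - 1) - semigroupInd p q (x + u * i) :=
  sub_nonneg.2 (semigroupInd_mono (D.le_shift x i) (D.dvd_shift x i))

theorem abs_progressionSum_le (D : ProgressionData p q u e η) (x : ℤ) (M : ℕ) :
    |progressionSum p q u x M| ≤ M := by
  refine (Finset.abs_sum_le_sum_abs _ _).trans ?_
  refine (Finset.sum_le_sum (g := fun _ => (1 : ℤ)) fun i _ => ?_).trans (by simp)
  rw [binaryCoeff, abs_le]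
  have h1 := D.ind_le_one (x + u * i)
  have h2 := D.ind_le_one (x + u * i - 1)
  have h3 := semigroupInd_nonneg p q (x + u * i)
  have h4 := semigroupInd_nonneg p q (x + u * i - 1)
  constructor <;> linarith

/-- In the split form the matched differences are nonnegative, by monotonicity within a class, and
enter with a minus sign; each of the e end terms is at most 1. -/
theorem progressionSum_le (D : ProgressionData p q u e η) (x : ℤ) (M : ℕ) :
    progressionSum p q u x M ≤ e := by
  rcases le_total M e with hM | hM
  · have := (abs_le.1 (D.abs_progressionSum_le x M)).2
    have : (M : ℤ) ≤ e := by exact_mod_cast hM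
    linarith
  · obtain ⟨L, rfl⟩ := Nat.exists_eq_add_of_le hM
    rw [progressionSum_split]
    have h1 := Finset.sum_nonneg fun i (_ : i ∈ Finset.range L) => D.shift_nonneg x i
    have h2 : ∑ i ∈ Finset.range e, (semigroupInd p q (x + u * ((L + i : ℕ) : ℤ)) -
          semigroupInd p q (x + u * i - 1)) ≤ ∑ i ∈ Finset.range e, (1 : ℤ) := by
      refine Finset.sum_le_sum fun i _ => ?_
      linarith [D.ind_le_one (x + u * ((L + i : ℕ) : ℤ)),
        semigroupInd_nonneg p q (x + u * i - 1)]
    simp only [Finset.sum_const, Finset.card_range, nsmul_eq_mul, mul_one] at h2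
    linarith

/-- A nonzero matched difference means that a multiple of q in the class of that term is crossed.
The window spans less than q and so holds at most one multiple, whose class is met by only one
index. -/
theorem sum_shift_le_one (D : ProgressionData p q u e η) (x : ℤ) {L : ℕ} (hL : e + L ≤ p) :
    ∑ i ∈ Finset.range L, (semigroupInd p q (x + u * ((e + i : ℕ) : ℤ) - 1) -
          semigroupInd p q (x + u * i)) ≤ 1 := by
  by_cases hall : ∀ i ∈ Finset.range L, semigroupInd p q (x + u * ((e + i : ℕ) : ℤ) - 1) -
          semigroupInd p q (x + u * i) = 0
  · rw [Finset.sum_eq_zero hall]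
    exact zero_le_one
  push Not at hall
  obtain ⟨c, hc, hne⟩ := hall
  rw [Finset.mem_range] at hc
  have hu0 : (0 : ℤ) ≤ u := by positivity
  have hwin : ∀ i : ℕ, i < L → ∀ J : ℕ, x + u * i < J * q →
      (J : ℤ) * q ≤ x + u * ((e + i : ℕ) : ℤ) - 1 →
      x < J * q ∧ (J : ℤ) * q < x + u * p := by
    intro i hi J h1 h2
    have h3 : ((e + i : ℕ) : ℤ) ≤ p := by omega
    have h4 := mul_le_mul_of_nonneg_left h3 hu0
    have h5 : (0 : ℤ) ≤ u * i := by positivity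
    constructor <;> linarith
  obtain ⟨J, hJ, hdJ, hJ1, hJ2⟩ := D.exists_jump (D.dvd_shift x c) hne (D.le_shift x c)
  rw [Finset.sum_eq_single_of_mem c (Finset.mem_range.2 hc)]
  · linarith [D.ind_le_one (x + u * ((e + c : ℕ) : ℤ) - 1), semigroupInd_nonneg p q (x + u * c)]
  · intro d hd hdc
    rw [Finset.mem_range] at hd
    by_contra hne'
    obtain ⟨J', hJ', hdJ', hJ1', hJ2'⟩ := D.exists_jump (D.dvd_shift x d) hne' (D.le_shift x d)
    have a := hwin c hc J hJ1 hJ2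
    have b := hwin d hd J' hJ1' hJ2'
    have hJJ := D.eq_of_mul_mem_window le_rfl a.1 a.2 b.1 b.2
    exact hdc (D.eq_of_dvd_window (by omega) (by omega) hdJ hdJ' hJJ).symm

theorem neg_le_sum_ends (D : ProgressionData p q u e η) (x : ℤ) (L : ℕ) :
    -(e : ℤ) ≤ ∑ i ∈ Finset.range e, (semigroupInd p q (x + u * ((L + i : ℕ) : ℤ)) -
          semigroupInd p q (x + u * i - 1)) := by
  have h2 : ∑ i ∈ Finset.range e, (-1 : ℤ) ≤
      ∑ i ∈ Finset.range e, (semigroupInd p q (x + u * ((L + i : ℕ) : ℤ)) -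
          semigroupInd p q (x + u * i - 1)) := by
    refine Finset.sum_le_sum fun i _ => ?_
    linarith [D.ind_le_one (x + u * i - 1),
      semigroupInd_nonneg p q (x + u * ((L + i : ℕ) : ℤ))]
  simpa using h2

theorem neg_le_progressionSum (D : ProgressionData p q u e η) (x : ℤ) {M : ℕ} (hM : M ≤ p) :
    -(e : ℤ) - 1 ≤ progressionSum p q u x M := by
  rcases le_total M e with hMe | hMe
  · have := (abs_le.1 (D.abs_progressionSum_le x M)).1
    have : (M : ℤ) ≤ e := by exact_mod_cast hMe
    linarith
  · obtain ⟨L, rfl⟩ := Nat.exists_eq_add_of_le hMe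
    rw [progressionSum_split]
    linarith [D.neg_le_sum_ends x L, D.sum_shift_le_one x hM]

/-- Going below -e forces equality throughout: a jump occurs, and every end term is -1, so the first
e predecessors lie in the semigroup and the last e terms do not. -/
theorem exists_of_progressionSum_lt (D : ProgressionData p q u e η) {x : ℤ} {M : ℕ} (hM : M ≤ p)
    (h : progressionSum p q u x M < -e) :
    ∃ c J : ℕ, e + c < M ∧ J < p ∧ (p : ℤ) ∣ x + u * c - J * q ∧ x + u * c < J * q ∧
      (J : ℤ) * q ≤ x + u * ((e + c : ℕ) : ℤ) - 1 ∧
      (∀ i < e, semigroupInd p q (x + u * i - 1) = 1) ∧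
      semigroupInd p q (x + u * ((M - 1 : ℕ) : ℤ)) = 0 := by
  have hMe : e ≤ M := by
    by_contra hlt
    have := (abs_le.1 (D.abs_progressionSum_le x M)).1
    have : (M : ℤ) < e := by exact_mod_cast not_le.1 hlt
    linarith
  obtain ⟨L, rfl⟩ := Nat.exists_eq_add_of_le hMe
  rw [progressionSum_split] at h
  have hends := D.neg_le_sum_ends x L
  have hone := D.sum_shift_le_one x hM
  have hex : ∃ c ∈ Finset.range L, semigroupInd p q (x + u * ((e + c : ℕ) : ℤ) - 1) -
          semigroupInd p q (x + u * c) ≠ 0 := by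
    refine Finset.exists_ne_zero_of_sum_ne_zero fun h0 => ?_
    rw [h0] at h
    linarith
  obtain ⟨c, hc, hne⟩ := hex
  rw [Finset.mem_range] at hc
  obtain ⟨J, hJ, hdJ, hJ1, hJ2⟩ := D.exists_jump (D.dvd_shift x c) hne (D.le_shift x c)
  have hterm : ∀ i ∈ Finset.range e, (-1 : ℤ) =
      semigroupInd p q (x + u * ((L + i : ℕ) : ℤ)) - semigroupInd p q (x + u * i - 1) := by
    refine (Finset.sum_eq_sum_iff_of_le fun i _ => ?_).1 ?_
    · linarith [D.ind_le_one (x + u * i - 1),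
        semigroupInd_nonneg p q (x + u * ((L + i : ℕ) : ℤ))]
    · simp only [Finset.sum_const, Finset.card_range, nsmul_eq_mul, mul_neg, mul_one]
      linarith
  refine ⟨c, J, by omega, hJ, hdJ, hJ1, hJ2, fun i hi => ?_, ?_⟩
  · linarith [D.ind_le_one (x + u * i - 1), hterm i (Finset.mem_range.2 hi),
      semigroupInd_nonneg p q (x + u * ((L + i : ℕ) : ℤ))]
  · have he := D.one_le
    have h1 := hterm (e - 1) (Finset.mem_range.2 (by omega))
    rw [show L + (e - 1) = e + L - 1 by omega] at h1
    linarith [D.ind_le_one (x + u * ((e - 1 : ℕ) : ℤ) - 1),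
      semigroupInd_nonneg p q (x + u * ((e + L - 1 : ℕ) : ℤ))]

/-- A position `z` beyond `J * q` outside the semigroup is congruent to a multiple `j * q` with
`J < j`. -/
theorem exists_class_gt (D : ProgressionData p q u e η) {z : ℤ} {J : ℕ} (hz : (J : ℤ) * q ≤ z)
    (h0 : semigroupInd p q z = 0) : ∃ j : ℕ, j < p ∧ J < j ∧ (p : ℤ) ∣ z - j * q := by
  obtain ⟨j, hj, hd⟩ := D.exists_class z
  rw [D.ind_eq hj hd] at h0
  have hq : (0 : ℤ) < q := by exact_mod_cast D.prime_q.pos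
  split_ifs at h0 with h
  · exact absurd h0 one_ne_zero
  · refine ⟨j, hj, ?_, hd⟩
    have : (J : ℤ) < j := lt_of_mul_lt_mul_right (by linarith) hq.le
    exact_mod_cast this

theorem exists_class_le (D : ProgressionData p q u e η) {z : ℤ} (h1 : semigroupInd p q z = 1) :
    ∃ j : ℕ, j < p ∧ (j : ℤ) * q ≤ z ∧ (p : ℤ) ∣ z - j * q := by
  obtain ⟨j, hj, hd⟩ := D.exists_class z
  rw [D.ind_eq hj hd] at h1
  split_ifs at h1 with h
  · exact ⟨j, hj, h, hd⟩
  · exact absurd h1 zero_ne_one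

/-- With η = -1 the classes decrease along the progression, whereas semigroup membership forces j ≤
J < j' for the classes of an early predecessor, the jump and the last term. The two congruences then
add up to j' - j + M = 2p, which is too large. -/
theorem neg_le_progressionSum_of_neg (D : ProgressionData p q u e (-1)) (x : ℤ) {M : ℕ}
    (hM : M ≤ p) : -(e : ℤ) ≤ progressionSum p q u x M := by
  by_contra hlt
  obtain ⟨c, J, hcM, hJ, hdJ, hJ1, hJ2, hone, hzero⟩ :=
    D.exists_of_progressionSum_lt hM (not_le.1 hlt)
  have he := D.one_le
  have hq : (0 : ℤ) < q := by exact_mod_cast D.prime_q.pos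
  have hu0 : (0 : ℤ) ≤ u := by positivity
  obtain ⟨j, hj, hjz, hdj⟩ := D.exists_class_le (hone (e - 1) (by omega))
  have hz' : (J : ℤ) * q ≤ x + u * ((M - 1 : ℕ) : ℤ) := by
    have : ((e + c : ℕ) : ℤ) ≤ ((M - 1 : ℕ) : ℤ) := by omega
    have := mul_le_mul_of_nonneg_left this hu0
    linarith
  obtain ⟨j', hj', hJj', hdj'⟩ := D.exists_class_gt hz' hzero
  have a1 := D.dvd_class_sub hdj hdJ (s := c - (e - 1 : ℕ)) (t := 1) (by ring)
  have a2 := D.dvd_class_sub hdJ hdj' (s := (M - 1 : ℕ) - c) (t := 0) (by ring)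
  have hjJ : (j : ℤ) < J + 1 := by
    refine lt_of_mul_lt_mul_right ?_ hq.le
    have h3 : ((e - 1 : ℕ) : ℤ) ≤ (p : ℤ) := by omega
    have h4 := mul_le_mul_of_nonneg_left h3 hu0
    have h5 := D.span_lt le_rfl
    have h6 : x ≤ x + u * c := by
      have : (0 : ℤ) ≤ u * c := by positivity
      linarith
    linarith
  -- The left side is a multiple of p strictly between 0 and 2p.
  have b1 : (J : ℤ) - j + (c + 1) = p := by
    have hd : (p : ℤ) ∣ (J : ℤ) - j + (c + 1) - p := by
      rw [dvd_sub_self_right]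
      rw [Nat.cast_sub he] at a1
      rwa [show (J : ℤ) - j - -1 * (c - (e - (1 : ℕ)) + 1 * e) = J - j + (c + 1) by
        push_cast; ring] at a1
    have := Int.eq_zero_of_abs_lt_dvd hd (by rw [abs_lt]; omega)
    omega
  have b2 : (j' : ℤ) - J + ((M - 1 : ℕ) - c) = p := by
    have hd : (p : ℤ) ∣ (j' : ℤ) - J + ((M - 1 : ℕ) - c) - p := by
      rw [dvd_sub_self_right]
      rwa [show (j' : ℤ) - J - -1 * ((M - 1 : ℕ) - c + 0 * e) = j' - J + ((M - 1 : ℕ) - c) by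
        ring] at a2
    have := Int.eq_zero_of_abs_lt_dvd hd (by rw [abs_lt]; omega)
    omega
  omega

/-- With η = 1 the congruences become the equalities J = j + c + e and j' = J + (M - 1 - c), where M
- 1 - c ≥ e; hence J is at distance at least e from both ends of the range of classes. -/
theorem exists_jump_of_progressionSum_lt (D : ProgressionData p q u e 1) {x : ℤ} {M : ℕ}
    (hM : M ≤ p) (h : progressionSum p q u x M < -e) :
    ∃ J : ℕ, e ≤ J ∧ J + e < p ∧ x < J * q ∧ (J : ℤ) * q < x + u * ((M - 1 : ℕ) : ℤ) := by
  obtain ⟨c, J, hcM, hJ, hdJ, hJ1, hJ2, hone, hzero⟩ := D.exists_of_progressionSum_lt hM h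
  have he := D.one_le
  have hq : (0 : ℤ) < q := by exact_mod_cast D.prime_q.pos
  have hu0 : (0 : ℤ) ≤ u := by positivity
  obtain ⟨j, hj, hjz, hdj⟩ := D.exists_class_le (hone 0 (by omega))
  have hz' : (J : ℤ) * q < x + u * ((M - 1 : ℕ) : ℤ) := by
    have : ((e + c : ℕ) : ℤ) ≤ ((M - 1 : ℕ) : ℤ) := by omega
    have := mul_le_mul_of_nonneg_left this hu0
    linarith
  obtain ⟨j', hj', hJj', hdj'⟩ := D.exists_class_gt hz'.le hzero
  have hx : x < J * q := by
    have : (0 : ℤ) ≤ u * c := by positivity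
    linarith
  have hjJ : (j : ℤ) < J := by
    refine lt_of_mul_lt_mul_right ?_ hq.le
    simp only [Nat.cast_zero, mul_zero] at hjz
    linarith
  have a1 := D.dvd_class_sub hdj hdJ (s := c) (t := 1) (by push_cast; ring)
  have a2 := D.dvd_class_sub hdJ hdj' (s := (M - 1 : ℕ) - c) (t := 0) (by ring)
  have b1 := Int.eq_zero_of_abs_lt_dvd a1 (by rw [abs_lt]; omega)
  have b2 := Int.eq_zero_of_abs_lt_dvd a2 (by rw [abs_lt]; omega)
  exact ⟨J, by omega, by omega, hx, hz'⟩

end ProgressionData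
-- Ternary coefficients as truncated sums of binary coefficients
/-- The coefficients of the polynomial `(1 + X + ⋯ + X ^ (p - 1)) * (1 - X ^ q)`. -/
def windowCoeff (p q m : ℕ) : ℤ :=
  (if m < p then 1 else 0) - if q ≤ m ∧ m < q + p then 1 else 0

open Polynomial in
theorem coeff_cyclotomic_prime_mul {p q : ℕ} (hp : p.Prime) (m : ℕ) :
    (cyclotomic p ℤ * (X ^ q - 1)).coeff m = -windowCoeff p q m := by
  have : Fact p.Prime := ⟨hp⟩
  have hc : ∀ k : ℕ, (cyclotomic p ℤ).coeff k = if k < p then 1 else 0 := by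
    intro k
    simp [cyclotomic_prime, finsetSum_coeff, coeff_X_pow]
  rw [mul_sub, mul_one, coeff_sub, coeff_mul_X_pow', hc, hc, windowCoeff, neg_sub]
  congr 1
  by_cases h : q ≤ m
  · simp only [h, true_and, if_true]
    exact if_congr (by omega) rfl rfl
  · simp [h]

open Polynomial in
theorem cyclotomic_mul_X_pow_sub_one {p q r : ℕ} (hp : p.Prime) (hq : q.Prime) (hpq : p ≠ q)
    (hr : r.Prime) (hrn : ¬ r ∣ p * q) :
    cyclotomic (p * q * r) ℤ * (X ^ (p * q) - 1) =
      expand ℤ r (cyclotomic (p * q) ℤ) * (cyclotomic p ℤ * (X ^ q - 1)) := by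
  rw [cyclotomic_expand_eq_cyclotomic_mul hr hrn]
  have h1 := cyclotomic_mul_prime_mul_cyclotomic hp hq hpq
  have h2 : (∑ j ∈ Finset.range p, (X : ℤ[X]) ^ (j * q)) * (X ^ q - 1) = X ^ (p * q) - 1 := by
    have := geom_sum_mul ((X : ℤ[X]) ^ q) p
    simp only [← pow_mul] at this
    simpa only [mul_comm] using this
  rw [← h2, ← h1]
  ring

open Polynomial in
theorem natDegree_cyclotomic_lt {n : ℕ} (hn : 1 < n) : (cyclotomic n ℤ).natDegree < n := by
  rw [natDegree_cyclotomic]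
  exact Nat.totient_lt n hn

open Polynomial in
theorem coeff_expand_mul {f g : ℤ[X]} {N : ℕ} (hf : f.natDegree < N) (r n : ℕ) :
    (expand ℤ r f * g).coeff n =
      ∑ i ∈ Finset.range N, if r * i ≤ n then f.coeff i * g.coeff (n - r * i) else 0 := by
  conv_lhs => rw [f.as_sum_range_C_mul_X_pow' hf]
  rw [map_sum, Finset.sum_mul, finsetSum_coeff]
  refine Finset.sum_congr rfl fun i _ => ?_
  rw [map_mul, expand_C, map_pow, expand_X, ← pow_mul, mul_assoc, coeff_C_mul, mul_comm _ g,
    coeff_mul_X_pow', mul_ite, mul_zero]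

theorem windowCoeff_of_le {p q m : ℕ} (h1 : p ≤ m) (h2 : q + p ≤ m) : windowCoeff p q m = 0 := by
  rw [windowCoeff, if_neg (by omega), if_neg (by omega), sub_zero]

-- Multiplication by X^{pq} - 1 gives a recurrence of step pq. The window polynomial has degree
-- below pq, so solving the recurrence amounts to reducing n - ri modulo pq.
open Polynomial in
theorem coeff_cyclotomic_ternary {p q r : ℕ} (hp : p.Prime) (hq : q.Prime) (hpq : p ≠ q)
    (hr : r.Prime) (hrn : ¬ r ∣ p * q) (n : ℕ) :
    (cyclotomic (p * q * r) ℤ).coeff n =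
      ∑ i ∈ Finset.range (p * q), if r * i ≤ n then
        binaryCoeff p q i * windowCoeff p q ((n - r * i) % (p * q)) else 0 := by
  have hp2 := hp.two_le
  have hq2 := hq.two_le
  have hN : 1 < p * q := by nlinarith
  have hsum : q + p ≤ p * q := by nlinarith
  have hple : p ≤ p * q := by nlinarith
  induction n using Nat.strong_induction_on with
  | _ n ih =>
    have hid := cyclotomic_mul_X_pow_sub_one hp hq hpq hr hrn
    rw [mul_sub_one (cyclotomic (p * q * r) ℤ)] at hid
    have h := congrArg (fun f : ℤ[X] => f.coeff n) hid
    simp only [coeff_expand_mul (natDegree_cyclotomic_lt hN), coeff_cyclotomic_prime_mul hp,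
      coeff_sub, coeff_mul_X_pow', coeff_cyclotomic_mul_prime hp hq hpq] at h
    have h2 : (if p * q ≤ n then (cyclotomic (p * q * r) ℤ).coeff (n - p * q) else 0) =
        ∑ i ∈ Finset.range (p * q), if p * q ≤ n ∧ r * i ≤ n - p * q then
          binaryCoeff p q i * windowCoeff p q ((n - p * q - r * i) % (p * q)) else 0 := by
      split_ifs with hn
      · rw [ih (n - p * q) (by omega)]
        simp only [hn, true_and]
      · simp [hn]
    rw [h2, sub_eq_iff_eq_add] at h
    rw [← sub_eq_iff_eq_add', ← Finset.sum_sub_distrib] at h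
    rw [← h]
    refine Finset.sum_congr rfl fun i _ => ?_
    by_cases hi : r * i ≤ n
    · by_cases hn : p * q ≤ n - r * i
      · rw [if_pos hi, if_pos hi, if_pos (by omega),
          windowCoeff_of_le (m := n - r * i) (by omega) (by omega)]
        rw [show n - p * q - r * i = n - r * i - p * q by omega, Nat.mod_eq_sub_mod hn]
        ring
      · rw [if_pos hi, if_pos hi, if_neg (by omega), Nat.mod_eq_of_lt (not_le.1 hn)]
        ring
    · rw [if_neg hi, if_neg hi, if_neg (by omega), sub_zero]

/-- The coefficients of `Φ_{pq}` up to degree `K`. -/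
def truncCoeff (p q : ℕ) (K z : ℤ) : ℤ := if z ≤ K then binaryCoeff p q z else 0

theorem windowCoeff_eq_sum {p q m : ℕ} :
    windowCoeff p q m = ∑ k ∈ Finset.range p, (if m = k then 1 else 0) -
      ∑ k ∈ Finset.range p, if m = q + k then 1 else 0 := by
  rw [windowCoeff]
  congr 1
  · simp
  · by_cases h : q ≤ m
    · obtain ⟨t, rfl⟩ := Nat.exists_eq_add_of_le h
      simp
    · rw [if_neg (by omega)]
      exact (Finset.sum_eq_zero fun k _ => if_neg (by omega)).symm

/-- The index `i` modulo `N` for which `n - r * i` has a prescribed residue. -/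
theorem mod_eq_iff_of_inverse {N n r i : ℕ} {u : ℤ} {d : ℕ} (hd : d < N) (hi : i < N)
    (hru : (N : ℤ) ∣ r * u - 1) (hin : r * i ≤ n) :
    (n - r * i) % N = d ↔ (i : ℤ) = (u * (n - d)) % N := by
  have hN : (0 : ℤ) < N := by omega
  have h1 : ((n - r * i) % N = d) ↔ (N : ℤ) ∣ (n - r * i) - d := by
    rw [← Int.emod_eq_emod_iff_emod_sub_eq_zero.trans Int.dvd_iff_emod_eq_zero.symm,
      Int.emod_eq_of_lt (a := d) (by omega) (by omega)]
    constructor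
    · intro h
      have : (((n - r * i : ℕ) % N : ℕ) : ℤ) = d := by exact_mod_cast h
      rw [Int.natCast_mod, Nat.cast_sub hin] at this
      push_cast at this
      exact this
    · intro h
      have : (((n - r * i : ℕ) % N : ℕ) : ℤ) = d := by
        rw [Int.natCast_mod, Nat.cast_sub hin]
        push_cast
        exact h
      exact_mod_cast this
  have h2 : ((i : ℤ) = (u * (n - d)) % N) ↔ (N : ℤ) ∣ i - u * (n - d) := by
    rw [← Int.emod_eq_emod_iff_emod_sub_eq_zero.trans Int.dvd_iff_emod_eq_zero.symm,
      Int.emod_eq_of_lt (a := i) (by omega) (by omega)]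
  rw [h1, h2]
  obtain ⟨c, hc⟩ := hru
  constructor
  · rintro ⟨a, ha⟩
    exact ⟨-u * a - i * c, by linear_combination -u * ha - i * hc⟩
  · rintro ⟨a, ha⟩
    exact ⟨-r * a - c * (n - d), by linear_combination (-(r : ℤ)) * ha - (n - d) * hc⟩

theorem sum_residue {p q n r : ℕ} {u : ℤ} (hr : 0 < r) {d : ℕ} (hd : d < p * q)
    (hru : ((p * q : ℕ) : ℤ) ∣ r * u - 1) :
    (∑ i ∈ Finset.range (p * q), if r * i ≤ n then
        binaryCoeff p q i * (if (n - r * i) % (p * q) = d then 1 else 0) else 0) =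
      truncCoeff p q ((n / r : ℕ) : ℤ) ((u * (n - d)) % (p * q : ℕ)) := by
  have hN : (0 : ℤ) < (p * q : ℕ) := by omega
  have h0 := Int.emod_nonneg (u * ((n : ℤ) - d)) hN.ne'
  have h1 := Int.emod_lt_of_pos (u * ((n : ℤ) - d)) hN
  obtain ⟨t, ht⟩ := Int.eq_ofNat_of_zero_le h0
  rw [ht] at h1
  rw [Finset.sum_eq_single_of_mem t (Finset.mem_range.2 (by exact_mod_cast h1))]
  · rw [ht, truncCoeff]
    have hle : ((t : ℕ) : ℤ) ≤ ((n / r : ℕ) : ℤ) ↔ r * t ≤ n := by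
      rw [Nat.cast_le, Nat.le_div_iff_mul_le hr, mul_comm]
    by_cases h : r * t ≤ n
    · rw [if_pos h, if_pos (hle.2 h), if_pos, mul_one]
      exact (mod_eq_iff_of_inverse hd (by exact_mod_cast h1) hru h).2 ht.symm
    · rw [if_neg h, if_neg (fun h' => h (hle.1 h'))]
  · intro i hi hit
    rw [Finset.mem_range] at hi
    split_ifs with h2 h3
    · have := (mod_eq_iff_of_inverse hd hi hru h2).1 h3
      rw [ht] at this
      exact absurd (by exact_mod_cast this) hit
    · rw [mul_zero]
    · rfl

open Polynomial in
theorem coeff_cyclotomic_ternary_eq_sum {p q r : ℕ} (hp : p.Prime) (hq : q.Prime) (hpq : p ≠ q)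
    (hr : r.Prime) (hrn : ¬ r ∣ p * q) {u : ℤ} (hru : ((p * q : ℕ) : ℤ) ∣ r * u - 1) (n : ℕ) :
    (cyclotomic (p * q * r) ℤ).coeff n =
      ∑ m ∈ Finset.range p,
        truncCoeff p q ((n / r : ℕ) : ℤ) ((u * (n - (m : ℕ))) % (p * q : ℕ)) -
      ∑ m ∈ Finset.range p,
        truncCoeff p q ((n / r : ℕ) : ℤ) ((u * (n - (q + m : ℕ))) % (p * q : ℕ)) := by
  have hp2 := hp.two_le
  have hq2 := hq.two_le
  have hsum : q + p ≤ p * q := by nlinarith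
  rw [coeff_cyclotomic_ternary hp hq hpq hr hrn]
  have hterm : ∀ m ∈ Finset.range p,
      truncCoeff p q ((n / r : ℕ) : ℤ) ((u * (n - (m : ℕ))) % (p * q : ℕ)) =
      (∑ i ∈ Finset.range (p * q), if r * i ≤ n then
        binaryCoeff p q i * (if (n - r * i) % (p * q) = m then 1 else 0) else 0) := by
    intro m hm
    rw [Finset.mem_range] at hm
    rw [sum_residue hr.pos (by omega) hru]
  have hterm' : ∀ m ∈ Finset.range p,
      truncCoeff p q ((n / r : ℕ) : ℤ) ((u * (n - (q + m : ℕ))) % (p * q : ℕ)) =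
      (∑ i ∈ Finset.range (p * q), if r * i ≤ n then
        binaryCoeff p q i * (if (n - r * i) % (p * q) = q + m then 1 else 0) else 0) := by
    intro m hm
    rw [Finset.mem_range] at hm
    rw [sum_residue hr.pos (by omega) hru]
  rw [Finset.sum_congr rfl hterm, Finset.sum_congr rfl hterm', Finset.sum_comm,
    Finset.sum_comm (s := Finset.range p), ← Finset.sum_sub_distrib]
  refine Finset.sum_congr rfl fun i _ => ?_
  split_ifs
  · rw [windowCoeff_eq_sum, mul_sub, Finset.mul_sum, Finset.mul_sum]
  · simp

/-- The sum of the coefficients of `Φ_{pq}` of degree at most `K`, along the progression of length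
`p` with common difference `u` and largest term `N`. -/
def truncSum (p q u : ℕ) (K N : ℤ) : ℤ :=
  ∑ m ∈ Finset.range p, truncCoeff p q K (N - u * m)

theorem truncSum_eq_progressionSum {p q u : ℕ} (hp : 0 < p) {K N : ℤ} {M : ℕ} (hM : M ≤ p)
    (h : ∀ i < p, N - u * ((p - 1 : ℕ) : ℤ) + u * i ≤ K ↔ i < M) :
    truncSum p q u K N = progressionSum p q u (N - u * ((p - 1 : ℕ) : ℤ)) M := by
  obtain ⟨L, rfl⟩ := Nat.exists_eq_add_of_le hM
  rw [truncSum, progressionSum, ← Finset.sum_range_reflect, Finset.sum_range_add]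
  rw [Finset.sum_eq_zero (s := Finset.range L), add_zero]
  · refine Finset.sum_congr rfl fun i hi => ?_
    rw [Finset.mem_range] at hi
    have := (h i (by omega)).2 hi
    rw [← show N - u * ((M + L - 1 - i : ℕ) : ℤ) = N - u * ((M + L - 1 : ℕ) : ℤ) + u * i by
      rw [Nat.cast_sub (by omega)]; ring] at this ⊢
    rw [truncCoeff, if_pos this]
  · intro i hi
    rw [Finset.mem_range] at hi
    have := (not_congr (h (M + i) (by omega))).2 (by omega)
    rw [← show N - u * ((M + L - 1 - (M + i) : ℕ) : ℤ) =
        N - u * ((M + L - 1 : ℕ) : ℤ) + u * ((M + i : ℕ) : ℤ) by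
      rw [Nat.cast_sub (by omega)]; ring] at this
    rw [truncCoeff, if_neg this]

theorem progressionSum_add {p q u : ℕ} (x : ℤ) (M L : ℕ) :
    progressionSum p q u x (M + L) =
      progressionSum p q u x M + progressionSum p q u (x + u * M) L := by
  rw [progressionSum, progressionSum, progressionSum, Finset.sum_range_add]
  congr 1
  refine Finset.sum_congr rfl fun i _ => ?_
  push_cast
  ring_nf

theorem exists_threshold {p u : ℕ} (hu : 0 < u) (x K : ℤ) :
    ∃ M ≤ p, ∀ i < p, x + u * i ≤ K ↔ i < M := by
  induction p with
  | zero => exact ⟨0, le_rfl, fun i hi => absurd hi (by omega)⟩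
  | succ p ih =>
    obtain ⟨M, hM, h⟩ := ih
    have hu' : (0 : ℤ) < u := by exact_mod_cast hu
    by_cases hK : x + u * p ≤ K
    · refine ⟨p + 1, le_rfl, fun i hi => iff_of_true ?_ hi⟩
      have : (i : ℤ) ≤ p := by omega
      have := mul_le_mul_of_nonneg_left this hu'.le
      linarith
    · refine ⟨M, by omega, fun i hi => ?_⟩
      rcases Nat.lt_succ_iff_lt_or_eq.1 hi with hi | rfl
      · exact h i hi
      · exact iff_of_false hK (by omega)
-- Each ternary coefficient as one signed progression
theorem Int.emod_eq_of_dvd_sub {N a b : ℤ} (h0 : 0 ≤ b) (h1 : b < N) (hd : N ∣ a - b) :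
    a % N = b := by
  rw [← Int.emod_eq_of_lt h0 h1]
  exact Int.emod_eq_emod_iff_emod_sub_eq_zero.2 (Int.emod_eq_zero_of_dvd hd)

theorem dvd_mul_sub_mod_mul (p q u : ℕ) :
    ((p * q : ℕ) : ℤ) ∣ u * q - (u % p : ℕ) * q := by
  refine ⟨(u / p : ℕ), ?_⟩
  have : (u : ℤ) = p * (u / p : ℕ) + (u % p : ℕ) := by exact_mod_cast (Nat.div_add_mod u p).symm
  push_cast at this ⊢
  linear_combination (q : ℤ) * this

namespace ProgressionData

variable {p q u e : ℕ} {η : ℤ}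

theorem span_lt' (D : ProgressionData p q u e η) : (u : ℤ) * ((p - 1 : ℕ) : ℤ) < q :=
  D.span_lt (Nat.sub_le p 1)

theorem u_pos (D : ProgressionData p q u e η) : (0 : ℤ) < u := by
  have := D.p_lt_u
  omega

/-- A negative position wraps to within q of pq, above the degree of Φ_{pq}; the coefficient
vanishes at both places, so the reduction modulo pq can be dropped. -/
theorem truncCoeff_emod (D : ProgressionData p q u e η) {K N t : ℤ} (hN0 : 0 ≤ N)
    (hN : N < (p * q : ℕ)) (ht0 : 0 ≤ t) (ht : t ≤ u * ((p - 1 : ℕ) : ℤ)) :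
    truncCoeff p q K ((N - t) % (p * q : ℕ)) = truncCoeff p q K (N - t) := by
  have hs := D.span_lt'
  have hp1 : (1 : ℤ) ≤ p := by exact_mod_cast D.prime_p.one_le
  have hp2 : (2 : ℤ) ≤ p := by exact_mod_cast D.prime_p.two_le
  have hqq : (q : ℤ) ≤ p * q := by
    have : (0 : ℤ) ≤ q := by positivity
    nlinarith
  rcases le_or_gt 0 (N - t) with h | h
  · rw [Int.emod_eq_of_lt h (by linarith)]
  · have : (N - t) % (p * q : ℕ) = N - t + (p * q : ℕ) := by
      refine Int.emod_eq_of_dvd_sub ?_ (by linarith) ⟨-1, by ring⟩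
      push_cast
      linarith
    rw [this, truncCoeff, truncCoeff, binaryCoeff_of_neg h,
      binaryCoeff_of_large D.prime_p D.prime_q D.p_ne_q, ite_self, ite_self]
    push_cast
    linarith

end ProgressionData

/-- Numerical data for a ternary cyclotomic polynomial of index `p * q * r`, where `r` is an inverse
of `u` modulo `p * q`. -/
structure TernaryData (p q r u e : ℕ) (η : ℤ) : Prop extends ProgressionData p q u e η where
  prime_r : r.Prime
  mul_lt_r : p * q < r
  dvd_r : ((p * q : ℕ) : ℤ) ∣ r * u - 1

namespace TernaryData

open Polynomial

variable {p q r u e : ℕ} {η : ℤ}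

theorem not_dvd (T : TernaryData p q r u e η) : ¬ r ∣ p * q := fun h =>
  absurd (Nat.le_of_dvd (Nat.mul_pos T.prime_p.pos T.prime_q.pos) h) (not_le.2 T.mul_lt_r)

theorem mul_pos (T : TernaryData p q r u e η) : (0 : ℤ) < (p * q : ℕ) := by
  exact_mod_cast Nat.mul_pos T.prime_p.pos T.prime_q.pos

theorem coeff_eq (T : TernaryData p q r u e η) (n : ℕ) :
    (cyclotomic (p * q * r) ℤ).coeff n =
      truncSum p q u ((n / r : ℕ) : ℤ) ((u * (n : ℤ)) % (p * q : ℕ)) -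
      truncSum p q u ((n / r : ℕ) : ℤ) ((u * ((n : ℤ) - q)) % (p * q : ℕ)) := by
  rw [coeff_cyclotomic_ternary_eq_sum T.prime_p T.prime_q T.p_ne_q T.prime_r T.not_dvd T.dvd_r]
  have hu := T.u_pos
  have key : ∀ (y : ℤ) (m : ℕ), m ∈ Finset.range p →
      truncCoeff p q ((n / r : ℕ) : ℤ) ((y - u * m) % (p * q : ℕ)) =
        truncCoeff p q ((n / r : ℕ) : ℤ) (y % (p * q : ℕ) - u * m) := by
    intro y m hm
    rw [Finset.mem_range] at hm
    rw [← T.truncCoeff_emod (Int.emod_nonneg _ T.mul_pos.ne') (Int.emod_lt_of_pos _ T.mul_pos)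
      (by positivity) (mul_le_mul_of_nonneg_left (by omega) hu.le), Int.emod_sub_emod]
  rw [truncSum, truncSum]
  congr 1
  · refine Finset.sum_congr rfl fun m hm => ?_
    rw [← key _ m hm, mul_sub]
  · refine Finset.sum_congr rfl fun m hm => ?_
    rw [← key _ m hm]
    push_cast
    ring_nf

theorem truncSum_of_le (T : TernaryData p q r u e η) {K N : ℤ} (h : N ≤ K) :
    truncSum p q u K N = progressionSum p q u (N - u * ((p - 1 : ℕ) : ℤ)) p := by
  refine truncSum_eq_progressionSum T.prime_p.pos le_rfl fun i hi => iff_of_true ?_ hi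
  have := mul_le_mul_of_nonneg_left (show (i : ℤ) ≤ ((p - 1 : ℕ) : ℤ) by omega) T.u_pos.le
  linarith

/-- Adding a large multiple of pqr to n preserves both residues, makes the truncation void and moves
n beyond the degree, where the coefficient is 0. -/
theorem progressionSum_eq (T : TernaryData p q r u e η) {n N N' : ℤ} (hn : 0 ≤ n)
    (hN : (u * n) % (p * q : ℕ) = N) (hN' : (u * (n - q)) % (p * q : ℕ) = N') :
    progressionSum p q u (N - u * ((p - 1 : ℕ) : ℤ)) p =
      progressionSum p q u (N' - u * ((p - 1 : ℕ) : ℤ)) p := by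
  lift n to ℕ using hn
  set d := (cyclotomic (p * q * r) ℤ).natDegree + 1 with hd
  have hpq := T.mul_pos
  have hr := T.prime_r.pos
  have h0 : (cyclotomic (p * q * r) ℤ).coeff (n + p * q * d * r) = 0 := by
    refine coeff_eq_zero_of_natDegree_lt ?_
    have : 1 ≤ p * q * r := Nat.mul_pos (by exact_mod_cast hpq) hr
    nlinarith
  have e1 : (u * ((n + p * q * d * r : ℕ) : ℤ)) % (p * q : ℕ) = N := by
    rw [← hN]
    refine Int.emod_eq_emod_iff_emod_sub_eq_zero.2 (Int.emod_eq_zero_of_dvd ⟨u * d * r, ?_⟩)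
    push_cast
    ring
  have e2 : (u * (((n + p * q * d * r : ℕ) : ℤ) - q)) % (p * q : ℕ) = N' := by
    rw [← hN']
    refine Int.emod_eq_emod_iff_emod_sub_eq_zero.2 (Int.emod_eq_zero_of_dvd ⟨u * d * r, ?_⟩)
    push_cast
    ring
  have hK : ((p * q : ℕ) : ℤ) ≤ (((n + p * q * d * r) / r : ℕ) : ℤ) := by
    rw [Nat.add_mul_div_right _ _ hr]
    exact_mod_cast le_add_left (Nat.le_mul_of_pos_right (p * q) (by omega))
  have b1 := Int.emod_lt_of_pos (u * (n : ℤ)) hpq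
  have b2 := Int.emod_lt_of_pos (u * ((n : ℤ) - q)) hpq
  rw [T.coeff_eq, e1, e2, T.truncSum_of_le (by linarith), T.truncSum_of_le (by linarith)] at h0
  linarith

/-- The progressions ending at N and N' are disjoint with the second above the first, so the cut at
K meets at most one of them. A cut in the first leaves its initial part; otherwise the equality of
the full sums leaves the tail of the second. -/
theorem exists_progressionSum (T : TernaryData p q r u e η) {K N N' : ℤ} (hNN : N + q ≤ N')
    (hV : progressionSum p q u (N - u * ((p - 1 : ℕ) : ℤ)) p =
      progressionSum p q u (N' - u * ((p - 1 : ℕ) : ℤ)) p) :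
    ∃ x M, M ≤ p ∧ truncSum p q u K N - truncSum p q u K N' = progressionSum p q u x M ∧
      (x + u * ((M - 1 : ℕ) : ℤ) ≤ N ∨ N' - u * ((p - 1 : ℕ) : ℤ) ≤ x) := by
  have hu := T.u_pos
  have hs := T.span_lt'
  rcases le_or_gt N K with hK | hK
  · obtain ⟨M, hM, h⟩ := exists_threshold (p := p) (by exact_mod_cast hu)
      (N' - u * ((p - 1 : ℕ) : ℤ)) K
    refine ⟨N' - u * ((p - 1 : ℕ) : ℤ) + u * M, p - M, Nat.sub_le _ _, ?_, Or.inr ?_⟩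
    · rw [T.truncSum_of_le hK, truncSum_eq_progressionSum T.prime_p.pos hM h, hV]
      have := progressionSum_add (p := p) (q := q) (u := u) (N' - u * ((p - 1 : ℕ) : ℤ)) M (p - M)
      rw [Nat.add_sub_cancel' hM] at this
      linarith
    · have : (0 : ℤ) ≤ u * M := by positivity
      linarith
  · obtain ⟨M, hM, h⟩ := exists_threshold (p := p) (by exact_mod_cast hu)
      (N - u * ((p - 1 : ℕ) : ℤ)) K
    refine ⟨N - u * ((p - 1 : ℕ) : ℤ), M, hM, ?_, Or.inl ?_⟩
    · rw [truncSum_eq_progressionSum T.prime_p.pos hM h,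
        truncSum_eq_progressionSum (N := N') (M := 0) T.prime_p.pos (Nat.zero_le _)]
      · simp [progressionSum]
      · intro i hi
        refine iff_of_false ?_ (by omega)
        have : (0 : ℤ) ≤ u * i := by positivity
        linarith
    · have := mul_le_mul_of_nonneg_left (show ((M - 1 : ℕ) : ℤ) ≤ ((p - 1 : ℕ) : ℤ) by omega) hu.le
      linarith

theorem mod_lt (T : TernaryData p q r u e η) : u % p < p := Nat.mod_lt _ T.prime_p.pos

theorem mod_pos (T : TernaryData p q r u e η) : 0 < u % p := by
  refine Nat.pos_of_ne_zero fun h => ?_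
  have h1 : (p : ℤ) ∣ u := by exact_mod_cast Nat.dvd_of_mod_eq_zero h
  have h2 : (p : ℤ) ∣ 1 := by
    have := dvd_sub (h1.mul_right (e : ℤ)) T.dvd_mul_sub
    rwa [sub_sub_cancel] at this
  have := T.prime_p.two_le
  have := Int.le_of_dvd one_pos h2
  omega

/-- Every coefficient is, up to a sign, a sum of coefficients of `Φ_{pq}` along a progression; the
sign restricts the position of the progression. -/
theorem coeff_cases (T : TernaryData p q r u e η) (n : ℕ) :
    (∃ x M, M ≤ p ∧ (cyclotomic (p * q * r) ℤ).coeff n = progressionSum p q u x M ∧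
      ∀ J : ℕ, x < J * q → (J : ℤ) * q < x + u * ((M - 1 : ℕ) : ℤ) → J < u % p ∨ p ≤ J + u % p) ∨
    ∃ x M, M ≤ p ∧ (cyclotomic (p * q * r) ℤ).coeff n = -progressionSum p q u x M ∧
      ∀ J : ℕ, x < J * q → (J : ℤ) * q < x + u * ((M - 1 : ℕ) : ℤ) → J + u % p < p ∨ u % p ≤ J := by
  have hpq := T.mul_pos
  have hq : (0 : ℤ) < q := by exact_mod_cast T.prime_q.pos
  have hv0 : (1 : ℤ) ≤ (u % p : ℕ) := by exact_mod_cast T.mod_pos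
  have hv1 : ((u % p : ℕ) : ℤ) + 1 ≤ p := by exact_mod_cast T.mod_lt
  have hs := T.span_lt'
  obtain ⟨c, hc⟩ := dvd_mul_sub_mod_mul p q u
  set v := u % p with hv
  have g0 : (q : ℤ) ≤ v * q := by nlinarith
  have g1 : (v : ℤ) * q + q ≤ p * q := by nlinarith
  have a0 := Int.emod_nonneg (u * (n : ℤ)) hpq.ne'
  have a1 := Int.emod_lt_of_pos (u * (n : ℤ)) hpq
  have a2 := Int.mul_ediv_add_emod (u * (n : ℤ)) (p * q : ℕ)
  rw [T.coeff_eq]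
  set N := (u * (n : ℤ)) % (p * q : ℕ) with hN
  push_cast at a1
  -- The second endpoint is N - vq modulo pq; whether it wraps around decides which progression is
  -- the upper one, hence the sign.
  rcases lt_or_ge N (v * q) with h | h
  · have hN' : (u * ((n : ℤ) - q)) % (p * q : ℕ) = N - v * q + (p * q : ℕ) := by
      refine Int.emod_eq_of_dvd_sub (by push_cast; linarith) (by linarith)
        ⟨u * n / (p * q : ℕ) - c - 1, ?_⟩
      linear_combination -hc - a2
    rw [hN']
    obtain ⟨x, M, hM, hS, hloc⟩ := T.exists_progressionSum (K := ((n / r : ℕ) : ℤ))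
      (N := N) (N' := N - v * q + (p * q : ℕ)) (by push_cast; linarith)
      (T.progressionSum_eq (by positivity) hN.symm hN')
    refine Or.inl ⟨x, M, hM, hS, fun J h1 h2 => ?_⟩
    rcases hloc with hl | hl
    · left
      have : (J : ℤ) < v := lt_of_mul_lt_mul_right (by linarith) hq.le
      exact_mod_cast this
    · right
      have : (p : ℤ) < J + v + 1 := by
        refine lt_of_mul_lt_mul_right ?_ hq.le
        push_cast at hl
        linarith
      omega
  · have hN' : (u * ((n : ℤ) - q)) % (p * q : ℕ) = N - v * q := by
      refine Int.emod_eq_of_dvd_sub (by linarith) (by push_cast; linarith)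
        ⟨u * n / (p * q : ℕ) - c, ?_⟩
      linear_combination -hc - a2
    rw [hN']
    obtain ⟨x, M, hM, hS, hloc⟩ := T.exists_progressionSum (K := ((n / r : ℕ) : ℤ))
      (N := N - v * q) (N' := N) (by linarith)
      (T.progressionSum_eq (by positivity) hN.symm hN').symm
    refine Or.inr ⟨x, M, hM, by linarith, fun J h1 h2 => ?_⟩
    rcases hloc with hl | hl
    · left
      have : (J : ℤ) + v < p := lt_of_mul_lt_mul_right (by linarith) hq.le
      exact_mod_cast this
    · right
      have : (v : ℤ) < J + 1 := lt_of_mul_lt_mul_right (by linarith) hq.le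
      omega

/-- A cut at x - 1 keeps the lower progression whole and removes exactly the last M terms of the
upper one. -/
theorem truncSum_sub (T : TernaryData p q r u e η) {x N N' : ℤ} {M : ℕ} (hM0 : 1 ≤ M) (hM : M ≤ p)
    (hN : N = x + u * ((M - 1 : ℕ) : ℤ)) (hN' : N' < x)
    (hV : progressionSum p q u (N - u * ((p - 1 : ℕ) : ℤ)) p =
      progressionSum p q u (N' - u * ((p - 1 : ℕ) : ℤ)) p) :
    truncSum p q u (x - 1) N' - truncSum p q u (x - 1) N = progressionSum p q u x M := by
  have hu := T.u_pos
  have hx : N - u * ((p - 1 : ℕ) : ℤ) + u * ((p - M : ℕ) : ℤ) = x := by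
    rw [hN, Nat.cast_sub hM, Nat.cast_sub hM0, Nat.cast_sub (hM0.trans hM)]
    ring
  rw [T.truncSum_of_le (by linarith), ← hV,
    truncSum_eq_progressionSum (M := p - M) T.prime_p.pos (Nat.sub_le _ _)]
  · have := progressionSum_add (p := p) (q := q) (u := u) (N - u * ((p - 1 : ℕ) : ℤ)) (p - M) M
    rw [Nat.sub_add_cancel hM, hx] at this
    linarith
  · intro i hi
    constructor
    · intro h
      have : (i : ℤ) < (p - M : ℕ) := lt_of_mul_lt_mul_left (by linarith) hu.le
      exact_mod_cast this
    · intro h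
      have := mul_le_mul_of_nonneg_left (show (i : ℤ) + 1 ≤ (p - M : ℕ) by omega) hu.le
      linarith

/-- Because pq < r, the remainder of n modulo r can realise any residue modulo pq, independently of
the quotient K. -/
theorem exists_index (T : TernaryData p q r u e η) {K N d : ℤ} (hK : 0 ≤ K) (hN0 : 0 ≤ N)
    (hN : N < (p * q : ℕ)) :
    ∃ n : ℕ, ((n / r : ℕ) : ℤ) = K ∧ (u * (n - d)) % (p * q : ℕ) = N := by
  have hpq := T.mul_pos
  have hr := T.mul_lt_r
  lift K to ℕ using hK
  have s0 := Int.emod_nonneg (r * N + d - r * K) hpq.ne'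
  have s1 := Int.emod_lt_of_pos (r * N + d - r * K) hpq
  have s2 := Int.mul_ediv_add_emod (r * N + d - r * K) (p * q : ℕ)
  obtain ⟨s, hs⟩ := Int.eq_ofNat_of_zero_le s0
  rw [hs] at s1 s2
  refine ⟨s + r * K, ?_, ?_⟩
  · rw [Nat.add_mul_div_left _ _ T.prime_r.pos, Nat.div_eq_of_lt (by omega), zero_add]
  · obtain ⟨c, hc⟩ := T.dvd_r
    refine Int.emod_eq_of_dvd_sub hN0 hN ⟨c * N - u * ((r * N + d - r * K) / (p * q : ℕ)), ?_⟩
    push_cast at *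
    linear_combination N * hc + u * s2

theorem exists_coeff_eq_neg (T : TernaryData p q r u e η) {x : ℤ} {M : ℕ} (hM0 : 1 ≤ M)
    (hM : M ≤ p) (hx : 0 < x) (h1 : ((u % p : ℕ) : ℤ) * q ≤ x + u * ((M - 1 : ℕ) : ℤ))
    (h2 : x + u * ((M - 1 : ℕ) : ℤ) < (p * q : ℕ)) :
    ∃ n, (cyclotomic (p * q * r) ℤ).coeff n = -progressionSum p q u x M := by
  have hu := T.u_pos
  have hpq := T.mul_pos
  have hv0 : (1 : ℤ) ≤ (u % p : ℕ) := by exact_mod_cast T.mod_pos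
  have hq : (0 : ℤ) < q := by exact_mod_cast T.prime_q.pos
  have g0 : (q : ℤ) ≤ (u % p : ℕ) * q := by nlinarith
  obtain ⟨c, hc⟩ := dvd_mul_sub_mod_mul p q u
  have hs := T.span_lt (i := M - 1) (by omega)
  obtain ⟨n, hnK, hn⟩ := T.exists_index (K := x - 1) (d := 0) (by linarith) (by positivity) h2
  rw [sub_zero] at hn
  have a2 := Int.mul_ediv_add_emod (u * (n : ℤ)) (p * q : ℕ)
  have hn' : (u * ((n : ℤ) - q)) % (p * q : ℕ) =
      x + u * ((M - 1 : ℕ) : ℤ) - (u % p : ℕ) * q := by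
    refine Int.emod_eq_of_dvd_sub (by linarith) (by linarith) ⟨u * n / (p * q : ℕ) - c, ?_⟩
    linear_combination -hc - a2 + hn
  refine ⟨n, ?_⟩
  rw [T.coeff_eq, hnK, ← T.truncSum_sub hM0 hM rfl (by linarith)
    (T.progressionSum_eq (by positivity) hn hn'), hn, hn']
  ring

theorem exists_coeff_eq (T : TernaryData p q r u e η) {x : ℤ} {M : ℕ} (hM0 : 1 ≤ M)
    (hM : M ≤ p) (hx : 0 < x)
    (h1 : ((p : ℤ) - (u % p : ℕ)) * q ≤ x + u * ((M - 1 : ℕ) : ℤ))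
    (h2 : x + u * ((M - 1 : ℕ) : ℤ) < (p * q : ℕ)) :
    ∃ n, (cyclotomic (p * q * r) ℤ).coeff n = progressionSum p q u x M := by
  have hu := T.u_pos
  have hpq := T.mul_pos
  have hv1 : ((u % p : ℕ) : ℤ) + 1 ≤ p := by exact_mod_cast T.mod_lt
  have hq : (0 : ℤ) < q := by exact_mod_cast T.prime_q.pos
  have g0 : (q : ℤ) ≤ ((p : ℤ) - (u % p : ℕ)) * q := by nlinarith
  obtain ⟨c, hc⟩ := dvd_mul_sub_mod_mul p q u
  have hs := T.span_lt (i := M - 1) (by omega)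
  obtain ⟨n, hnK, hn⟩ := T.exists_index (K := x - 1) (d := q) (by linarith) (by positivity) h2
  have a2 := Int.mul_ediv_add_emod (u * ((n : ℤ) - q)) (p * q : ℕ)
  have hn' : (u * (n : ℤ)) % (p * q : ℕ) =
      x + u * ((M - 1 : ℕ) : ℤ) - ((p : ℤ) - (u % p : ℕ)) * q := by
    refine Int.emod_eq_of_dvd_sub (by linarith) (by linarith)
      ⟨u * (n - q) / (p * q : ℕ) + c + 1, ?_⟩
    push_cast at *
    linear_combination hc - a2 + hn
  refine ⟨n, ?_⟩
  rw [T.coeff_eq, hnK, ← T.truncSum_sub hM0 hM rfl (by linarith)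
    (T.progressionSum_eq (by positivity) hn' hn).symm, hn, hn']

end TernaryData
-- Progressions attaining the extreme sums
namespace ProgressionData

variable {p q u e : ℕ} {η : ℤ}

theorem progressionSum_eq_mul {M : ℕ} {x ε : ℤ} (h : ∀ i < M, binaryCoeff p q (x + u * i) = ε) :
    progressionSum p q u x M = M * ε := by
  rw [progressionSum, Finset.sum_congr rfl fun i hi => h i (Finset.mem_range.1 hi)]
  simp

theorem ind_eq_of_block (D : ProgressionData p q u e η) {z : ℤ} {j J : ℕ} (hj : j < p)
    (hd : (p : ℤ) ∣ z - j * q) (h0 : (J : ℤ) * q ≤ z) (h1 : z < (J + 1) * q) :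
    semigroupInd p q z = if j ≤ J then 1 else 0 := by
  rw [D.ind_eq hj hd]
  have hq : (0 : ℤ) < q := by exact_mod_cast D.prime_q.pos
  refine if_congr ⟨fun h => ?_, fun h => ?_⟩ rfl rfl
  · have : (j : ℤ) < J + 1 := lt_of_mul_lt_mul_right (by linarith) hq.le
    omega
  · have := mul_le_mul_of_nonneg_right (show (j : ℤ) ≤ J by exact_mod_cast h) hq.le
    linarith

theorem dvd_affine (D : ProgressionData p q u e η) {x t i j s : ℤ} (hx : (p : ℤ) ∣ x - t * q)
    (hj : (p : ℤ) ∣ η * (j - t) - (i - s * e)) : (p : ℤ) ∣ (x + u * i - s) - j * q := by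
  obtain ⟨a, ha⟩ := hx
  obtain ⟨c, hc⟩ := D.dvd_mul_sub
  obtain ⟨d, hd⟩ := D.dvd_sub
  obtain ⟨k, hk⟩ := hj
  refine ⟨a + c * s - (j - t) * d - u * k, ?_⟩
  linear_combination ha + s * hc - (j - t) * hd - u * hk

theorem exists_mem_block (D : ProgressionData p q u e η) (J : ℕ) (t : ℤ) :
    ∃ x : ℤ, (p : ℤ) ∣ x - t * q ∧ (J : ℤ) * q < x ∧ x + u * e < (J + 1) * q := by
  have hp : (0 : ℤ) < p := by exact_mod_cast D.prime_p.pos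
  have h0 := Int.emod_nonneg (t * q - J * q - 1) hp.ne'
  have h1 := Int.emod_lt_of_pos (t * q - J * q - 1) hp
  have h2 := Int.mul_ediv_add_emod (t * q - J * q - 1) p
  refine ⟨J * q + 1 + (t * q - J * q - 1) % p, ⟨-((t * q - J * q - 1) / p), ?_⟩, ?_, ?_⟩
  · linear_combination h2
  · linarith
  · have h3 : ((e : ℤ) + 1) ≤ p := by
      have := D.two_mul_lt
      omega
    have h4 := mul_le_mul_of_nonneg_left h3 (show (0 : ℤ) ≤ u by positivity)
    have h5 : (p : ℤ) < u := by exact_mod_cast D.p_lt_u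
    have h6 := D.span_lt le_rfl
    linarith

/-- A progression of length `e` that starts in the block of `(p - 1 - e) * q` and along which the
coefficients of `Φ_{pq}` are constant. The functions `j` and `j'` give the residue classes of its
terms and of their predecessors. -/
theorem exists_progressionSum_eq_mul (D : ProgressionData p q u e η) (t ε : ℤ) (j j' : ℕ → ℕ)
    (h : ∀ i < e, j i < p ∧ j' i < p ∧ (p : ℤ) ∣ η * (j i - t) - i ∧
      (p : ℤ) ∣ η * (j' i - t) - (i - e))
    (hε : ∀ i < e, ((if j i ≤ p - 1 - e then 1 else 0) - if j' i ≤ p - 1 - e then 1 else 0) = ε) :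
    ∃ x : ℤ, ((p - 1 - e : ℕ) : ℤ) * q < x ∧ x + u * e < p * q ∧
      progressionSum p q u x e = e * ε := by
  have he := D.one_le
  have hep := D.two_mul_lt
  have hu : (0 : ℤ) ≤ u := by positivity
  have hq : (0 : ℤ) < q := by exact_mod_cast D.prime_q.pos
  obtain ⟨x, hx, hx0, hx1⟩ := D.exists_mem_block (p - 1 - e) t
  refine ⟨x, hx0, hx1.trans_le (mul_le_mul_of_nonneg_right (by omega) hq.le),
    progressionSum_eq_mul fun i hi => ?_⟩
  obtain ⟨h1, h2, h3, h4⟩ := h i hi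
  have hi' := mul_le_mul_of_nonneg_left (show (i : ℤ) ≤ e by omega) hu
  have hi0 : (0 : ℤ) ≤ u * i := by positivity
  rw [binaryCoeff, D.ind_eq_of_block (j := j i) (J := p - 1 - e) h1
      (by simpa using D.dvd_affine hx (s := 0) (by simpa using h3)) (by linarith) (by linarith),
    D.ind_eq_of_block (j := j' i) (J := p - 1 - e) h2
      (D.dvd_affine hx (by simpa using h4)) (by linarith) (by linarith), hε i hi]

theorem exists_progressionSum_eq (D : ProgressionData p q u e η) :
    ∃ x : ℤ, ((p - 1 - e : ℕ) : ℤ) * q < x ∧ x + u * e < p * q ∧ progressionSum p q u x e = e := by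
  have hep := D.two_mul_lt
  rcases D.eta with rfl | rfl
  -- Term i has class i, at most p - 1 - e and so in the semigroup; its predecessor has class i - e
  -- modulo p, among the top e classes and so outside.
  · have := D.exists_progressionSum_eq_mul 0 1 (fun i => i) (fun i => i + p - e)
      (fun i hi => ⟨by omega, by omega, ⟨0, by ring⟩, ⟨1, by omega⟩⟩)
      fun i hi => by rw [if_pos (by omega), if_neg (by omega), sub_zero]
    simpa using this
  · have := D.exists_progressionSum_eq_mul ((p - 1 - e : ℕ) : ℤ) 1 (fun i => p - 1 - e - i)
      (fun i => p - 1 - i) (fun i hi => ⟨by omega, by omega, ⟨0, by omega⟩, ⟨0, by omega⟩⟩)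
      fun i hi => by rw [if_pos (by omega), if_neg (by omega), sub_zero]
    simpa using this

theorem exists_progressionSum_eq_neg (D : ProgressionData p q u e η) :
    ∃ x : ℤ, ((p - 1 - e : ℕ) : ℤ) * q < x ∧ x + u * e < p * q ∧
      progressionSum p q u x e = -e := by
  have hep := D.two_mul_lt
  rcases D.eta with rfl | rfl
  · have := D.exists_progressionSum_eq_mul (-e) (-1) (fun i => i + p - e)
      (fun i => i + p - 2 * e) (fun i hi => ⟨by omega, by omega, ⟨1, by omega⟩, ⟨1, by omega⟩⟩)
      fun i hi => by rw [if_neg (by omega), if_pos (by omega), zero_sub]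
    simpa using this
  · have := D.exists_progressionSum_eq_mul (-1) (-1) (fun i => p - 1 - i)
      (fun i => e - 1 - i) (fun i hi => ⟨by omega, by omega, ⟨-1, by omega⟩, ⟨0, by omega⟩⟩)
      fun i hi => by rw [if_neg (by omega), if_pos (by omega), zero_sub]
    simpa using this

/-- The progression starts at Jq - p with J = p - 1 - e, in the class of Jq but just below it, so
the first term is outside the semigroup. The predecessor of the last term is in the same class, and
is past Jq because ue > p; this gains one over the block of length e. -/
theorem exists_progressionSum_eq_neg_add_one (D : ProgressionData p q u e 1) :
    ∃ x : ℤ, 0 < x ∧ ((p - 1 - e : ℕ) : ℤ) * q < x + u * e ∧ x + u * e < p * q ∧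
      progressionSum p q u x (e + 1) = -(e + 1) := by
  have he := D.one_le
  have hep := D.two_mul_lt
  have hu : (0 : ℤ) ≤ u := by positivity
  have hq : (0 : ℤ) < q := by exact_mod_cast D.prime_q.pos
  have hpu := D.p_lt_mul
  have hs := D.span_lt (i := e + 1) (by omega)
  have hu1 : (p : ℤ) < u := by exact_mod_cast D.p_lt_u
  have hp0 : (0 : ℤ) < p := by exact_mod_cast D.prime_p.pos
  push_cast at hs
  obtain ⟨J, hJ⟩ : ∃ J, J = p - 1 - e := ⟨_, rfl⟩
  rw [← hJ]
  have hJ1 : (q : ℤ) ≤ J * q := le_mul_of_one_le_left hq.le (by omega)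
  have hJ2 : ((J : ℤ) + 1) * q ≤ p * q := mul_le_mul_of_nonneg_right (by omega) hq.le
  have hx : (p : ℤ) ∣ (J * q - p) - (J : ℤ) * q := ⟨-1, by ring⟩
  refine ⟨J * q - p, by linarith, by linarith, by linarith, ?_⟩
  rw [progressionSum_eq_mul (ε := -1)]
  · push_cast
    ring
  intro i hi
  have hi' := mul_le_mul_of_nonneg_left (show (i : ℤ) ≤ e by omega) hu
  have d1 := D.dvd_affine (i := i) (j := ((J + i : ℕ) : ℤ)) (s := 0) hx ⟨0, by push_cast; ring⟩
  have d2 := D.dvd_affine (i := i) (j := ((J + i - e : ℕ) : ℤ)) (s := 1) hx ⟨0, by omega⟩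
  rw [sub_zero] at d1
  have n1 : ¬ ((J + i : ℕ) : ℤ) * q ≤ J * q - p + u * i := by
    rw [not_le]
    rcases Nat.eq_zero_or_pos i with rfl | h0
    · simpa using hp0
    · have := mul_le_mul_of_nonneg_right (show (J : ℤ) + 1 ≤ (J + i : ℕ) by omega) hq.le
      linarith
  have n2 : ((J + i - e : ℕ) : ℤ) * q ≤ J * q - p + u * i - 1 := by
    rcases Nat.lt_succ_iff_lt_or_eq.1 hi with h0 | rfl
    · have := mul_le_mul_of_nonneg_right (show ((J + i - e : ℕ) : ℤ) ≤ J - 1 by omega) hq.le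
      have : (0 : ℤ) ≤ u * i := by positivity
      linarith
    · rw [Nat.add_sub_cancel]
      linarith
  rw [binaryCoeff, D.ind_eq (by omega) d1, D.ind_eq (by omega) d2, if_neg n1, if_pos n2, zero_sub]

end ProgressionData

/-! ### The diameter for η = -1 and η = 1 -/

open Polynomial in
theorem cyclotomicDiameter_eq {n : ℕ} {a b : ℤ} (ha : 0 < a) (hb : 0 < b)
    (hle : ∀ m, (cyclotomic n ℤ).coeff m ≤ a) (hge : ∀ m, -b ≤ (cyclotomic n ℤ).coeff m)
    (hmax : ∃ m, (cyclotomic n ℤ).coeff m = a) (hmin : ∃ m, (cyclotomic n ℤ).coeff m = -b) :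
    cyclotomicDiameter n = a + b := by
  obtain ⟨m, hm⟩ := hmax
  obtain ⟨k, hk⟩ := hmin
  have hm' : m ∈ Finset.range ((cyclotomic n ℤ).natDegree + 1) :=
    Finset.mem_range.2 (Nat.lt_succ_of_le (le_natDegree_of_ne_zero (by rw [hm]; exact ha.ne')))
  have hk' : k ∈ Finset.range ((cyclotomic n ℤ).natDegree + 1) :=
    Finset.mem_range.2 (Nat.lt_succ_of_le (le_natDegree_of_ne_zero (by rw [hk]; omega)))
  have h1 : maxCoeff (cyclotomic n ℤ) = a := le_antisymm (Finset.sup'_le _ _ fun i _ => hle i)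
    (hm ▸ Finset.le_sup' (cyclotomic n ℤ).coeff hm')
  have h2 : minCoeff (cyclotomic n ℤ) = -b :=
    le_antisymm (hk ▸ Finset.inf'_le (cyclotomic n ℤ).coeff hk')
      (Finset.le_inf' _ _ fun i _ => hge i)
  rw [cyclotomicDiameter, h1, h2, sub_neg_eq_add]

namespace TernaryData

open Polynomial

variable {p q r u e : ℕ} {η : ℤ}

/-- Progressions of positive length that end in one of the last `e + 1` blocks. -/
theorem exists_coeff_eq_neg_of_le (T : TernaryData p q r u e η) (hv : u % p + e < p) {x : ℤ}
    {M : ℕ} (hM : M + 1 ≤ p) (hx : 0 < x) (h1 : ((p - 1 - e : ℕ) : ℤ) * q ≤ x + u * M)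
    (h2 : x + u * M < p * q) :
    ∃ n, (cyclotomic (p * q * r) ℤ).coeff n = -progressionSum p q u x (M + 1) := by
  refine T.exists_coeff_eq_neg (Nat.succ_pos M) hM hx ?_ (by simpa using h2)
  rw [Nat.add_sub_cancel]
  refine le_trans (mul_le_mul_of_nonneg_right ?_ (by positivity)) h1
  omega

theorem exists_coeff_eq_of_le (T : TernaryData p q r u e η) (hv : e < u % p) {x : ℤ}
    {M : ℕ} (hM : M + 1 ≤ p) (hx : 0 < x) (h1 : ((p - 1 - e : ℕ) : ℤ) * q ≤ x + u * M)
    (h2 : x + u * M < p * q) :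
    ∃ n, (cyclotomic (p * q * r) ℤ).coeff n = progressionSum p q u x (M + 1) := by
  refine T.exists_coeff_eq (Nat.succ_pos M) hM hx ?_ (by simpa using h2)
  rw [Nat.add_sub_cancel]
  refine le_trans (mul_le_mul_of_nonneg_right ?_ (by positivity)) h1
  omega

theorem exists_coeff_eq_of_block (T : TernaryData p q r u e η) {x : ℤ}
    (h1 : ((p - 1 - e : ℕ) : ℤ) * q < x) (h2 : x + u * e < p * q) :
    (u % p + e < p → ∃ n, (cyclotomic (p * q * r) ℤ).coeff n = -progressionSum p q u x e) ∧
      (e < u % p → ∃ n, (cyclotomic (p * q * r) ℤ).coeff n = progressionSum p q u x e) := by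
  have he := T.one_le
  have hep := T.two_mul_lt
  have hu := T.u_pos
  obtain ⟨M, rfl⟩ := Nat.exists_eq_add_of_le' he
  have hM : (0 : ℤ) ≤ u * M := by positivity
  have hx : 0 < x := lt_of_le_of_lt (by positivity) h1
  push_cast at h2
  exact ⟨fun h => T.exists_coeff_eq_neg_of_le h (by omega) hx (by linarith) (by linarith),
    fun h => T.exists_coeff_eq_of_le h (by omega) hx (by linarith) (by linarith)⟩

/-- Since 2e < p, at least one sign is available for progressions in the block of p - 1 - e; sums e
and -e both occur there, so either sign suffices. -/
theorem exists_coeff_eq_e (T : TernaryData p q r u e η) :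
    ∃ n, (cyclotomic (p * q * r) ℤ).coeff n = e := by
  have hep := T.two_mul_lt
  obtain ⟨x, h1, h2, hx⟩ := T.exists_progressionSum_eq
  obtain ⟨y, h3, h4, hy⟩ := T.exists_progressionSum_eq_neg
  rcases lt_or_ge (u % p + e) p with h | h
  · have := (T.exists_coeff_eq_of_block h3 h4).1 h
    rwa [hy, neg_neg] at this
  · have := (T.exists_coeff_eq_of_block h1 h2).2 (by omega)
    rwa [hx] at this

theorem exists_coeff_eq_neg_e (T : TernaryData p q r u e η) :
    ∃ n, (cyclotomic (p * q * r) ℤ).coeff n = -e := by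
  have hep := T.two_mul_lt
  obtain ⟨x, h1, h2, hx⟩ := T.exists_progressionSum_eq
  obtain ⟨y, h3, h4, hy⟩ := T.exists_progressionSum_eq_neg
  rcases lt_or_ge (u % p + e) p with h | h
  · have := (T.exists_coeff_eq_of_block h1 h2).1 h
    rwa [hx] at this
  · have := (T.exists_coeff_eq_of_block h3 h4).2 (by omega)
    rwa [hy] at this

theorem diameter_eq_two_mul (T : TernaryData p q r u e (-1)) :
    cyclotomicDiameter (p * q * r) = 2 * e := by
  have he : (0 : ℤ) < e := by exact_mod_cast T.one_le
  rw [two_mul]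
  refine cyclotomicDiameter_eq he he (fun n => ?_) (fun n => ?_) T.exists_coeff_eq_e
    T.exists_coeff_eq_neg_e
  all_goals
    rcases T.coeff_cases n with ⟨x, M, hM, hS, -⟩ | ⟨x, M, hM, hS, -⟩ <;>
    linarith [T.progressionSum_le x M, T.neg_le_progressionSum_of_neg x hM]

/-- The sum -e-1 needs e ≤ J < p - e. If v ≤ e, the locations in `coeff_cases` exclude this for the
plus sign, so only the maximum grows to e + 1; if v ≥ p - e, the minus sign is excluded and only the
minimum drops to -e-1. -/
theorem diameter_eq_two_mul_add_one (T : TernaryData p q r u e 1)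
    (hv : u % p ≤ e ∨ p ≤ u % p + e) : cyclotomicDiameter (p * q * r) = 2 * e + 1 := by
  have he : (0 : ℤ) < e := by exact_mod_cast T.one_le
  have hep := T.two_mul_lt
  have hge : ∀ (x : ℤ) (M : ℕ), M ≤ p → (∀ J : ℕ, e ≤ J → J + e < p → x < J * q →
      (J : ℤ) * q < x + u * ((M - 1 : ℕ) : ℤ) → False) → -(e : ℤ) ≤ progressionSum p q u x M := by
    intro x M hM h
    by_contra hlt
    obtain ⟨J, h1, h2, h3, h4⟩ := T.exists_jump_of_progressionSum_lt hM (not_le.1 hlt)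
    exact h J h1 h2 h3 h4
  obtain ⟨y, hy0, hy1, hy2, hy⟩ := T.exists_progressionSum_eq_neg_add_one
  rcases hv with hv | hv
  · rw [show (2 * e + 1 : ℤ) = (e + 1) + e by ring]
    refine cyclotomicDiameter_eq (by linarith) he (fun n => ?_) (fun n => ?_) ?_
      T.exists_coeff_eq_neg_e
    · rcases T.coeff_cases n with ⟨x, M, hM, hS, -⟩ | ⟨x, M, hM, hS, -⟩ <;>
      linarith [T.progressionSum_le x M, T.neg_le_progressionSum x hM]
    · rcases T.coeff_cases n with ⟨x, M, hM, hS, hJ⟩ | ⟨x, M, hM, hS, -⟩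
      · rw [hS]
        refine hge x M hM fun J h1 h2 h3 h4 => ?_
        have := hJ J h3 h4
        omega
      · linarith [T.progressionSum_le x M]
    · have := T.exists_coeff_eq_neg_of_le (by omega) (by omega) hy0 hy1.le hy2
      rwa [hy, neg_neg] at this
  · rw [show (2 * e + 1 : ℤ) = e + (e + 1) by ring]
    refine cyclotomicDiameter_eq he (by linarith) (fun n => ?_) (fun n => ?_)
      T.exists_coeff_eq_e ?_
    · rcases T.coeff_cases n with ⟨x, M, hM, hS, -⟩ | ⟨x, M, hM, hS, hJ⟩
      · linarith [T.progressionSum_le x M]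
      · rw [hS, neg_le]
        refine hge x M hM fun J h1 h2 h3 h4 => ?_
        have := hJ J h3 h4
        omega
    · rcases T.coeff_cases n with ⟨x, M, hM, hS, -⟩ | ⟨x, M, hM, hS, -⟩ <;>
      linarith [T.progressionSum_le x M, T.neg_le_progressionSum x hM]
    · have := T.exists_coeff_eq_of_le (by omega) (by omega) hy0 hy1.le hy2
      rwa [hy] at this

end TernaryData

/-! ### Choice of the primes and of e -/

theorem exists_prime_gt_dvd_sub {m : ℕ} (hm : m ≠ 0) {a : ℤ} (ha : IsCoprime a m) (N : ℕ) :
    ∃ q : ℕ, N < q ∧ q.Prime ∧ (m : ℤ) ∣ q - a := by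
  have : NeZero m := ⟨hm⟩
  obtain ⟨q, hq, hqp, h⟩ := Nat.forall_exists_prime_gt_and_eq_mod
    ((ZMod.coe_int_isUnit_iff_isCoprime a m).2 ha.symm) N
  refine ⟨q, hq, hqp, ?_⟩
  rw [← ZMod.intCast_zmod_eq_zero_iff_dvd]
  push_cast
  rw [h, sub_self]

/-- Dirichlet's theorem provides arbitrarily large primes for the required residue classes. -/
theorem exists_ternaryData {p e v : ℕ} {η : ℤ} (hp : p.Prime) (he : 1 ≤ e) (hep : 2 * e < p)
    (hv : v < p) (hve : (p : ℤ) ∣ v * e - 1) (hη : η = 1 ∨ η = -1) (N : ℕ) :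
    ∃ q r, N < q ∧ p < q ∧ q < r ∧ TernaryData p q r (v + p) e η := by
  have hp0 := hp.pos
  have hd : (p : ℤ) ∣ (v + p : ℕ) * e - 1 := by
    rw [show (((v + p : ℕ) : ℤ) * e - 1) = (v * e - 1) + p * e by push_cast; ring]
    exact dvd_add hve (dvd_mul_right _ _)
  have hv0 : 0 < v := by
    refine Nat.pos_of_ne_zero fun h => ?_
    have h1 : (p : ℤ) ∣ 1 := by simpa [h] using hve
    have := Int.le_of_dvd one_pos h1
    have := hp.two_le
    omega
  have hcp : IsCoprime ((v + p : ℕ) : ℤ) p := by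
    obtain ⟨c, hc⟩ := hd
    exact ⟨e, -c, by linear_combination hc⟩
  have hcp' : IsCoprime (η * ((v + p : ℕ) : ℤ)) p := by
    rcases hη with rfl | rfl
    · simpa using hcp
    · rw [neg_one_mul]
      exact hcp.neg_left
  -- The size of q gives up < q for u = v + p, and also makes u coprime to q, so that u is
  -- invertible modulo pq.
  obtain ⟨q, hq, hqp, hqd⟩ := exists_prime_gt_dvd_sub hp.ne_zero hcp' (N + (v + p) * p)
  have hqu : (v + p) * p < q := by omega
  have hvq : v + p ≤ (v + p) * p := Nat.le_mul_of_pos_right _ hp0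
  have hcq : IsCoprime ((v + p : ℕ) : ℤ) q :=
    Nat.isCoprime_iff_coprime.2
      (Nat.coprime_of_lt_prime (by omega) (by omega) hqp).symm
  have hcpq : IsCoprime ((v + p : ℕ) : ℤ) ((p * q : ℕ) : ℤ) := by
    push_cast at *
    exact hcp.mul_right hcq
  obtain ⟨a, b, hab⟩ := hcpq
  obtain ⟨r, hr, hrp, hrd⟩ := exists_prime_gt_dvd_sub (m := p * q) (a := a)
    (Nat.mul_ne_zero hp.ne_zero hqp.ne_zero) ⟨((v + p : ℕ) : ℤ), b, by linear_combination hab⟩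
    (p * q)
  refine ⟨q, r, by omega, by omega, lt_of_le_of_lt (Nat.le_mul_of_pos_left q hp0) hr,
    ⟨⟨hp, hqp, he, hep, by omega, hqu, hd, hqd, hη⟩, hrp, hr, ?_⟩⟩
  obtain ⟨c, hc⟩ := hrd
  exact ⟨((v + p : ℕ) : ℤ) * c - b, by linear_combination ((v + p : ℕ) : ℤ) * hc + hab⟩

theorem exists_inverse_mod {p e : ℕ} (hp : p.Prime) (he : 1 ≤ e) (hep : e < p) :
    ∃ v : ℕ, v < p ∧ (p : ℤ) ∣ v * e - 1 := by
  have hc : IsCoprime (e : ℤ) (p : ℤ) :=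
    Nat.isCoprime_iff_coprime.2 (Nat.coprime_of_lt_prime (by omega) hep hp).symm
  obtain ⟨a, b, hab⟩ := hc
  have hp0 : (0 : ℤ) < p := by exact_mod_cast hp.pos
  have h0 := Int.emod_nonneg a hp0.ne'
  have h1 := Int.emod_lt_of_pos a hp0
  have h2 := Int.mul_ediv_add_emod a p
  refine ⟨(a % p).toNat, by omega, ⟨-(a / p) * e - b, ?_⟩⟩
  rw [Int.toNat_of_nonneg h0]
  linear_combination hab + (e : ℤ) * h2

theorem solubleInLargePrimes_two_mul {p e : ℕ} (hp : p.Prime) (he : 1 ≤ e) (hep : 2 * e < p) :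
    SolubleInLargePrimes p (2 * (e : ℤ)) := by
  intro N
  obtain ⟨v, hv, hve⟩ := exists_inverse_mod hp he (by omega)
  obtain ⟨q, r, hN, hpq, hqr, T⟩ := exists_ternaryData hp he hep hv hve (Or.inr rfl) N
  exact ⟨q, r, T.prime_q, T.prime_r, hN, hN.trans hqr, hpq, hqr, T.diameter_eq_two_mul⟩

theorem solubleInLargePrimes_sub_two_mul {p k : ℕ} (hp : p.Prime) (hodd : Odd p)
    (hp3 : 2 * k + 3 ≤ p) (hk : k = 0 ∨ 4 * (k + 1) ^ 2 < p) : SolubleInLargePrimes p ((p : ℤ) - 2 * (k : ℤ)) := by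
  intro N
  obtain ⟨m, hm⟩ := hodd
  obtain ⟨e, rfl⟩ : ∃ e, m = e + k := ⟨m - k, by omega⟩
  obtain ⟨v, hv, hve⟩ := exists_inverse_mod hp (e := e) (by omega) (by omega)
  obtain ⟨q, r, hN, hpq, hqr, T⟩ :=
    exists_ternaryData hp (by omega) (by omega) hv hve (Or.inl rfl) N
  refine ⟨q, r, T.prime_q, T.prime_r, hN, hN.trans hqr, hpq, hqr, ?_⟩
  rw [T.diameter_eq_two_mul_add_one]
  · rw [hm]
    push_cast
    ring
  rw [Nat.add_mod_right, Nat.mod_eq_of_lt hv]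
  by_contra! hcon
  obtain ⟨c, hc⟩ := hve
  -- If the condition fails, then e < v < p - e with 2e = p - 1 - 2k.
  have ht : |2 * (v : ℤ) - p| ≤ 2 * k := by
    rw [abs_le]
    omega
  -- Here 2e ≡ -(2k + 1) modulo p, so 4ve ≡ 4 becomes this congruence. For k ≥ 1 the size is at most
  -- 2k(2k + 1) + 4 < 4(k + 1)² < p, so the expression is zero, against the oddness of the product.
  have hdvd : (p : ℤ) ∣ (2 * (v : ℤ) - p) * (2 * k + 1) + 4 := by
    refine ⟨-4 * c + 2 * v - 2 * k - 1, ?_⟩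
    have hpk : (p : ℤ) = 2 * (e + k) + 1 := by exact_mod_cast hm
    linear_combination (-4 : ℤ) * hc - 2 * v * hpk
  have hzero : (2 * (v : ℤ) - p) * (2 * k + 1) + 4 = 0 := by
    refine Int.eq_zero_of_abs_lt_dvd hdvd ?_
    rcases hk with rfl | hk
    · simp only [Nat.cast_zero, mul_zero, abs_le] at ht
      omega
    · have hk' : 4 * ((k : ℤ) + 1) ^ 2 < p := by exact_mod_cast hk
      refine (abs_add_le _ _).trans_lt ?_
      rw [abs_mul, abs_of_nonneg (show (0 : ℤ) ≤ 2 * k + 1 by positivity),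
        abs_of_nonneg (show (0 : ℤ) ≤ 4 by norm_num)]
      nlinarith
  have hpar : Odd ((2 * (v : ℤ) - p) * (2 * k + 1)) := by
    refine Odd.mul ⟨v - (e + k) - 1, ?_⟩ ⟨k, rfl⟩
    rw [hm]
    push_cast
    ring
  obtain ⟨w, hw⟩ := hpar
  omega

theorem corollary7 (p : ℕ) (hp : p.Prime) (hodd : Odd p) :
    SolubleInLargePrimes p 2 ∧
    (∀ h : ℕ, 3 ≤ h → (h : ℝ) < Real.sqrt (p : ℝ) →
      SolubleInLargePrimes p (2 * (h : ℤ))) ∧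
    SolubleInLargePrimes p (p : ℤ) ∧
    (∀ k : ℕ, 1 ≤ k → (k : ℝ) < Real.sqrt (p : ℝ) / 2 - 1 →
      SolubleInLargePrimes p ((p : ℤ) - 2 * (k : ℤ))) := by
  have hp3 : 3 ≤ p := by
    have := hp.two_le
    obtain ⟨m, hm⟩ := hodd
    omega
  refine ⟨?_, fun h h3 hlt => ?_, ?_, fun k _ hlt => ?_⟩
  · simpa using solubleInLargePrimes_two_mul (e := 1) hp le_rfl (by omega)
  · rw [Real.lt_sqrt (by positivity)] at hlt
    have hlt' : h ^ 2 < p := by exact_mod_cast hlt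
    exact solubleInLargePrimes_two_mul hp (by omega) (by nlinarith)
  · simpa using solubleInLargePrimes_sub_two_mul (k := 0) hp hodd hp3 (Or.inl rfl)
  · have hlt' : 2 * ((k : ℝ) + 1) < Real.sqrt p := by linarith
    rw [Real.lt_sqrt (by positivity)] at hlt'
    have hk : (2 * (k + 1)) ^ 2 < p := by exact_mod_cast hlt'
    exact solubleInLargePrimes_sub_two_mul hp hodd (by nlinarith) (Or.inr (by linarith))
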